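/- Let $M$ be a free abelian group of finite rank $n$, let $N=\mathrm{Hom}(M,\mathbb Z)$ be its dual, $N_{\mathbb R}=N\otimes_{\mathbb Z}\mathbb R$, and let $\Sigma$ be a complete regular fan in $N_{\mathbb R}$, i.e. a finite fan of strongly convex rational polyhedral cones that cover $N_{\mathbb R}$, each of which is generated by a part of a $\mathbb Z$-basis of $N$. Let $X=X_\Sigma$ be the corresponding smooth complete (for example, smooth projective) toric variety over $\mathbb C$, glued from the affine charts $\mathrm{Spec}\,\mathbb C[\sigma^\vee\cap M]$, $\sigma\in\Sigma$. Let $T=\mathrm{Hom}(M,\mathbb C^*)$ be the torus acting on $X$, regarded as a subgroup of the group $\mathrm{Aut}(X)$ of automorphisms of $X$ over $\mathbb C$, let $\mathcal N(T)\subset\mathrm{Aut}(X)$ be its normalizer, and put $\mathcal W(X)=\mathcal N(T)/T$. Let $GL(M)\cong GL(n,\mathbb Z)$ be the group of automorphisms of $M$, acting on $N_{\mathbb R}=\mathrm{Hom}(M,\mathbb R)$ by $(\gamma v)(m)=v(\gamma^{-1}m)$ and on $T$ by $(\gamma t)(m)=t(\gamma^{-1}m)$. Then the group $$\{\gamma\in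 GL(M) : \gamma(\Sigma)=\Sigma\}$$ of symmetries of $\Sigma$ is finite, and $\mathcal W(X)$ is isomorphic to it. More precisely, there is an isomorphism that is induced by the conjugation action of $\mathcal N(T)$ on $T$: it maps the class of $g\in\mathcal N(T)$ to an element $\gamma$ such that $gtg^{-1}=\gamma t$ for all $t\in T$. -/

import Mathlib

open CategoryTheory CategoryTheory.Limits AlgebraicGeometry

noncomputable section

namespace Toric

/-! ### Cones and fans

`M` is a lattice (a free abelian group of finite rank) and `N = Hom(M, ℤ)` is the dual lattice. -/

/-- The real vector space `N_ℝ = N ⊗ ℝ`, realised as `Hom(M, ℝ)`; the pairing of `m : M` with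
`v : NReal M` is the value `v m`. -/
abbrev NReal (M : Type) [AddCommGroup M] : Type := M →ₗ[ℤ] ℝ

/-- The inclusion of the dual lattice `N = Hom(M, ℤ)` in `N_ℝ`. -/
def toReal {M : Type} [AddCommGroup M] (n : Module.Dual ℤ M) : NReal M :=
  (Algebra.linearMap ℤ ℝ).comp n

/-- The cone in `N_ℝ` generated by a set of lattice vectors of `N`. -/
def latticeCone {M : Type} [AddCommGroup M] (s : Set (Module.Dual ℤ M)) :
    PointedCone ℝ (NReal M) :=
  PointedCone.hull ℝ (toReal '' s)

/-- `σ` is generated by finitely many lattice vectors. -/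
def IsRationalPolyhedral {M : Type} [AddCommGroup M] (σ : PointedCone ℝ (NReal M)) : Prop :=
  ∃ s : Set (Module.Dual ℤ M), s.Finite ∧ σ = latticeCone s

/-- `σ` is regular: it is generated by a part of a `ℤ`-basis of `N`. -/
def IsRegularCone {M : Type} [AddCommGroup M] (σ : PointedCone ℝ (NReal M)) : Prop :=
  ∃ (b : Module.Basis (Fin (Module.finrank ℤ M)) ℤ (Module.Dual ℤ M))
    (s : Set (Fin (Module.finrank ℤ M))), σ = latticeCone (b '' s)

/-- `τ` is a face of `σ`: `τ = σ ∩ m^⊥` for some `m` that is nonnegative on `σ`. For rational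
polyhedral cones, to which this is applied, supporting functionals can be taken in the lattice. -/
def IsFace {M : Type} [AddCommGroup M] (τ σ : PointedCone ℝ (NReal M)) : Prop :=
  ∃ m : M, (∀ v ∈ σ, 0 ≤ v m) ∧ ∀ v, v ∈ τ ↔ v ∈ σ ∧ v m = 0

/-- A (finite, rational polyhedral) fan in `N_ℝ`. -/
structure Fan (M : Type) [AddCommGroup M] where
  /-- The cones of the fan. -/
  cones : Set (PointedCone ℝ (NReal M))
  finite : cones.Finite
  rational : ∀ σ ∈ cones, IsRationalPolyhedral σ
  stronglyConvex : ∀ σ ∈ cones, σ.toConvexCone.Salient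
  face_mem : ∀ σ ∈ cones, ∀ τ, IsFace τ σ → τ ∈ cones
  inter_isFace : ∀ σ ∈ cones, ∀ τ ∈ cones, IsFace (σ ⊓ τ) σ ∧ IsFace (σ ⊓ τ) τ

/-- A fan is complete if its cones cover `N_ℝ`. -/
def Fan.IsComplete {M : Type} [AddCommGroup M] (Δ : Fan M) : Prop :=
  ∀ v : NReal M, ∃ σ ∈ Δ.cones, v ∈ σ

/-- A fan is regular if all its cones are. -/
def Fan.IsRegular {M : Type} [AddCommGroup M] (Δ : Fan M) : Prop :=
  ∀ σ ∈ Δ.cones, IsRegularCone σ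

/-- The poset of cones of a fan, ordered by inclusion. -/
abbrev Fan.Cone {M : Type} [AddCommGroup M] (Δ : Fan M) : Type :=
  {σ : PointedCone ℝ (NReal M) // σ ∈ Δ.cones}

/-! ### Affine schemes over `ℂ` -/

/-- The category of schemes over `ℂ`. -/
abbrev SchemeOverC : Type 1 := Over (Spec (CommRingCat.of ℂ))

/-- The spectrum of a commutative `ℂ`-algebra, as a scheme over `ℂ`. -/
def specC (A : Type) [CommRing A] [Algebra ℂ A] : SchemeOverC :=
  Over.mk (Spec.map (CommRingCat.ofHom (algebraMap ℂ A)))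

/-- The morphism of spectra induced by a homomorphism of `ℂ`-algebras. -/
def specCMap {A B : Type} [CommRing A] [Algebra ℂ A] [CommRing B] [Algebra ℂ B]
    (f : A →ₐ[ℂ] B) : specC B ⟶ specC A :=
  Over.homMk (Spec.map (CommRingCat.ofHom f.toRingHom)) (by
    simp only [specC, Over.mk_left, Over.mk_hom, ← Spec.map_comp, ← CommRingCat.ofHom_comp]
    congr 2
    exact f.comp_algebraMap)

theorem specCMap_id (A : Type) [CommRing A] [Algebra ℂ A] :
    specCMap (AlgHom.id ℂ A) = 𝟙 (specC A) := by
  apply Over.OverMorphism.ext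
  exact Spec.map_id (CommRingCat.of A)

theorem specCMap_comp {A B C : Type} [CommRing A] [Algebra ℂ A] [CommRing B] [Algebra ℂ B]
    [CommRing C] [Algebra ℂ C] (f : A →ₐ[ℂ] B) (g : B →ₐ[ℂ] C) :
    specCMap (g.comp f) = specCMap g ≫ specCMap f := by
  apply Over.OverMorphism.ext
  exact Spec.map_comp (CommRingCat.ofHom f.toRingHom) (CommRingCat.ofHom g.toRingHom)

/-! ### The affine charts -/

/-- The semigroup `S_σ = σ^∨ ∩ M`. -/
def dualMonoid {M : Type} [AddCommGroup M] (σ : PointedCone ℝ (NReal M)) : AddSubmonoid M where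
  carrier := {m | ∀ v ∈ σ, 0 ≤ v m}
  zero_mem' := fun v _ => by simp
  add_mem' := fun {a b} ha hb v hv => by
    rw [map_add]; exact add_nonneg (ha v hv) (hb v hv)

theorem dualMonoid_anti {M : Type} [AddCommGroup M] {τ σ : PointedCone ℝ (NReal M)}
    (h : τ ≤ σ) : dualMonoid σ ≤ dualMonoid τ :=
  fun _ hm v hv => hm v (h hv)

/-- The coordinate ring `ℂ[S_σ]` of the affine chart `U_σ`. -/
abbrev ChartRing {M : Type} [AddCommGroup M] (σ : PointedCone ℝ (NReal M)) : Type :=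
  AddMonoidAlgebra ℂ (dualMonoid σ)

/-- The inclusion `ℂ[S_σ] → ℂ[S_τ]`, for `τ ⊆ σ`. -/
def chartRingMap {M : Type} [AddCommGroup M] {τ σ : PointedCone ℝ (NReal M)} (h : τ ≤ σ) :
    ChartRing σ →ₐ[ℂ] ChartRing τ :=
  AddMonoidAlgebra.mapDomainAlgHom ℂ ℂ (AddSubmonoid.inclusion (dualMonoid_anti h))

@[simp] theorem chartRingMap_single {M : Type} [AddCommGroup M]
    {τ σ : PointedCone ℝ (NReal M)} (h : τ ≤ σ) (m : dualMonoid σ) (c : ℂ) :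
    chartRingMap h (AddMonoidAlgebra.single m c) =
      AddMonoidAlgebra.single (AddSubmonoid.inclusion (dualMonoid_anti h) m) c := by
  simp [chartRingMap]

theorem chartRing_algHom_ext {M : Type} [AddCommGroup M] {σ : PointedCone ℝ (NReal M)}
    {B : Type} [CommRing B] [Algebra ℂ B] {f g : ChartRing σ →ₐ[ℂ] B}
    (h : ∀ m : dualMonoid σ, f (AddMonoidAlgebra.single m 1) = g (AddMonoidAlgebra.single m 1)) :
    f = g :=
  AddMonoidAlgebra.algHom_ext h (Subsingleton.elim _ _)

/-- The diagram `σ ↦ U_σ = Spec ℂ[S_σ]` of affine charts of a fan. -/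
def Fan.charts {M : Type} [AddCommGroup M] (Δ : Fan M) : Δ.Cone ⥤ SchemeOverC where
  obj σ := specC (ChartRing σ.1)
  map f := specCMap (chartRingMap (leOfHom f))
  map_id σ := by
    rw [← specCMap_id]; congr 1
    apply chartRing_algHom_ext
    intro m; simp; rfl
  map_comp f g := by
    rw [← specCMap_comp]; congr 1
    apply chartRing_algHom_ext
    intro m; simp; rfl

/-! ### Faces give open immersions, and the charts can be glued -/

theorem isFace_le {M : Type} [AddCommGroup M] {τ σ : PointedCone ℝ (NReal M)}
    (h : IsFace τ σ) : τ ≤ σ := by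
  obtain ⟨m, -, h⟩ := h
  exact fun v hv => ((h v).1 hv).1

/-- If `τ = σ ∩ m^⊥`, then every `u ∈ S_τ` satisfies `u + k m ∈ S_σ` for some `k`. -/
theorem exists_add_nsmul_mem {M : Type} [AddCommGroup M] {τ σ : PointedCone ℝ (NReal M)}
    (hσ : IsRationalPolyhedral σ) (m : M) (hm : ∀ v ∈ σ, 0 ≤ v m)
    (hτ : ∀ v, v ∈ τ ↔ v ∈ σ ∧ v m = 0) (u : M) (hu : u ∈ dualMonoid τ) :
    ∃ k : ℕ, u + k • m ∈ dualMonoid σ := by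
  obtain ⟨s, hs, rfl⟩ := hσ
  have key : ∀ t : Set (Module.Dual ℤ M), t.Finite → t ⊆ s →
      ∃ k : ℕ, ∀ n ∈ t, 0 ≤ toReal n (u + k • m) := by
    intro t ht
    induction t, ht using Set.Finite.induction_on with
    | empty => intro _; exact ⟨0, by simp⟩
    | @insert a t _ _ ih =>
      intro hts
      obtain ⟨k, hk⟩ := ih ((Set.subset_insert _ _).trans hts)
      have hmem : ∀ n ∈ s, toReal n ∈ latticeCone s :=
        fun n hn => PointedCone.subset_hull ⟨n, hn, rfl⟩
      have ha := hmem a (hts (Set.mem_insert _ _))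
      have h0 := hm _ ha
      obtain ⟨l, hl⟩ : ∃ l : ℕ, 0 ≤ toReal a (u + l • m) := by
        rcases h0.eq_or_lt with h | h
        · exact ⟨0, by simpa using hu _ ((hτ _).2 ⟨ha, h.symm⟩)⟩
        · obtain ⟨l, hl⟩ := exists_nat_gt (-(toReal a u) / toReal a m)
          refine ⟨l, ?_⟩
          rw [div_lt_iff₀ h] at hl
          rw [map_add, map_nsmul, nsmul_eq_mul]
          linarith
      refine ⟨k + l, fun n hn => ?_⟩
      rcases Set.mem_insert_iff.1 hn with rfl | hn'
      · rw [map_add, map_nsmul, nsmul_eq_mul] at hl ⊢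
        push_cast
        have : (0 : ℝ) ≤ k * toReal n m := by positivity
        linarith
      · have h1 := hk n hn'
        have h2 := hm _ (hmem n (hts hn))
        rw [map_add, map_nsmul, nsmul_eq_mul] at h1 ⊢
        push_cast
        have : (0 : ℝ) ≤ l * toReal n m := by positivity
        linarith
  obtain ⟨k, hk⟩ := key s hs le_rfl
  refine ⟨k, fun v hv => ?_⟩
  induction hv using Submodule.span_induction with
  | mem x hx => obtain ⟨n, hn, rfl⟩ := hx; exact hk n hn
  | zero => simp
  | add x y _ _ hx hy => rw [LinearMap.add_apply]; exact add_nonneg hx hy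
  | smul c x _ hx => exact mul_nonneg c.2 hx

/-- If `τ = σ ∩ m^⊥`, then `ℂ[S_τ]` is the localization of `ℂ[S_σ]` at `χ^m`. -/
theorem isLocalization_chartRingMap {M : Type} [AddCommGroup M] {τ σ : PointedCone ℝ (NReal M)}
    (hσ : IsRationalPolyhedral σ) (h : τ ≤ σ) (m : dualMonoid σ)
    (hτ : ∀ v, v ∈ τ ↔ v ∈ σ ∧ v (m : M) = 0) :
    @IsLocalization.Away _ _ (AddMonoidAlgebra.single m (1 : ℂ)) (ChartRing τ) _
      (chartRingMap h).toRingHom.toAlgebra := by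
  let _ := (chartRingMap h).toRingHom.toAlgebra
  have halg : ∀ x, algebraMap (ChartRing σ) (ChartRing τ) x = chartRingMap h x := fun _ => rfl
  have hpow : ∀ k : ℕ, (AddMonoidAlgebra.single m (1 : ℂ) : ChartRing σ) ^ k =
      AddMonoidAlgebra.single (k • m) 1 := fun k => by simp [AddMonoidAlgebra.single_pow]
  refine (isLocalization_iff _ _).2 ⟨?_, ?_, ?_⟩
  · rintro ⟨_, k, rfl⟩
    have hneg : -(m : M) ∈ dualMonoid τ := fun v hv => by simp [((hτ v).1 hv).2]
    have hunit : IsUnit (chartRingMap h (AddMonoidAlgebra.single m 1)) := by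
      rw [chartRingMap_single]
      refine IsUnit.of_mul_eq_one (AddMonoidAlgebra.single ⟨_, hneg⟩ 1) ?_
      rw [AddMonoidAlgebra.single_mul_single, AddMonoidAlgebra.one_def, one_mul]
      congr 1
      ext
      simp
    rw [halg]
    simpa using hunit.pow k
  · intro z
    have : ∃ (k : ℕ) (x : ChartRing σ),
        z * chartRingMap h (AddMonoidAlgebra.single (k • m) 1) = chartRingMap h x := by
      induction z using AddMonoidAlgebra.induction_linear with
      | zero => exact ⟨0, 0, by simp⟩
      | add x y hx hy =>
        obtain ⟨k, a, hk⟩ := hx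
        obtain ⟨l, b, hl⟩ := hy
        refine ⟨k + l, a * AddMonoidAlgebra.single (l • m) 1 +
          b * AddMonoidAlgebra.single (k • m) 1, ?_⟩
        have : (AddMonoidAlgebra.single ((k + l) • m) 1 : ChartRing σ) =
            AddMonoidAlgebra.single (k • m) 1 * AddMonoidAlgebra.single (l • m) 1 := by
          rw [AddMonoidAlgebra.single_mul_single, add_smul, one_mul]
        rw [this, map_add, map_mul, map_mul, map_mul, ← hk, ← hl]
        ring
      | single u c =>
        obtain ⟨k, hk⟩ := exists_add_nsmul_mem hσ m m.2 hτ u u.2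
        refine ⟨k, AddMonoidAlgebra.single ⟨_, hk⟩ c, ?_⟩
        rw [chartRingMap_single, chartRingMap_single, AddMonoidAlgebra.single_mul_single, mul_one]
        congr 1
    obtain ⟨k, x, hx⟩ := this
    exact ⟨⟨x, _, k, rfl⟩, by simpa only [hpow, halg] using hx⟩
  · intro x y hxy
    refine ⟨1, ?_⟩
    have hinj : Function.Injective (chartRingMap h) :=
      AddMonoidAlgebra.mapDomain_injective (AddSubmonoid.inclusion_injective _)
    rw [hinj hxy]

theorem Fan.exists_cut {M : Type} [AddCommGroup M] (Δ : Fan M) {τ σ : Δ.Cone} (f : τ ⟶ σ) :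
    ∃ m : dualMonoid σ.1, ∀ v, v ∈ τ.1 ↔ v ∈ σ.1 ∧ v (m : M) = 0 := by
  obtain ⟨m, hm, h⟩ := (Δ.inter_isFace σ.1 σ.2 τ.1 τ.2).1
  rw [inf_eq_right.2 (leOfHom f)] at h
  exact ⟨⟨m, hm⟩, h⟩

instance Fan.charts_isOpenImmersion {M : Type} [AddCommGroup M] (Δ : Fan M) {τ σ : Δ.Cone}
    (f : τ ⟶ σ) : IsOpenImmersion (Δ.charts.map f).left := by
  obtain ⟨m, hm⟩ := Δ.exists_cut f
  let _ := (chartRingMap (leOfHom f)).toRingHom.toAlgebra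
  have := isLocalization_chartRingMap (Δ.rational _ σ.2) (leOfHom f) m hm
  exact IsOpenImmersion.of_isLocalization (AddMonoidAlgebra.single m (1 : ℂ))

theorem Fan.mem_range_charts_map_iff {M : Type} [AddCommGroup M] (Δ : Fan M) {τ σ : Δ.Cone}
    (f : τ ⟶ σ) (m : dualMonoid σ.1) (hm : ∀ v, v ∈ τ.1 ↔ v ∈ σ.1 ∧ v (m : M) = 0)
    (x : PrimeSpectrum (ChartRing σ.1)) :
    (∃ y, (Δ.charts.map f).left y = x) ↔ AddMonoidAlgebra.single m (1 : ℂ) ∉ x.asIdeal := by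
  let _ := (chartRingMap (leOfHom f)).toRingHom.toAlgebra
  have := isLocalization_chartRingMap (Δ.rational _ σ.2) (leOfHom f) m hm
  have := PrimeSpectrum.localization_away_comap_range (ChartRing τ.1)
    (AddMonoidAlgebra.single m (1 : ℂ))
  exact Set.ext_iff.1 this x

instance Fan.charts_isLocallyDirected {M : Type} [AddCommGroup M] (Δ : Fan M) :
    (Δ.charts ⋙ Over.forget _ ⋙ Scheme.forget).IsLocallyDirected where
  cond := by
    intro i j k fi fj xi xj hx
    obtain ⟨mi, hi⟩ := Δ.exists_cut fi
    obtain ⟨mj, hj⟩ := Δ.exists_cut fj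
    have hface : IsFace (i.1 ⊓ j.1) i.1 := (Δ.inter_isFace i.1 i.2 j.1 j.2).1
    let l : Δ.Cone := ⟨i.1 ⊓ j.1, Δ.face_mem _ i.2 _ hface⟩
    let fli : l ⟶ i := homOfLE (show i.1 ⊓ j.1 ≤ i.1 from inf_le_left)
    let flj : l ⟶ j := homOfLE (show i.1 ⊓ j.1 ≤ j.1 from inf_le_right)
    have hl : ∀ v, v ∈ l.1 ↔ v ∈ k.1 ∧ v ((mi + mj : dualMonoid k.1) : M) = 0 := by
      intro v
      have h1 := hi v
      have h2 := hj v
      change v ∈ i.1 ∧ v ∈ j.1 ↔ v ∈ k.1 ∧ v ((mi : M) + mj) = 0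
      rw [map_add]
      constructor
      · rintro ⟨a, b⟩
        exact ⟨(h1.1 a).1, by rw [(h1.1 a).2, (h2.1 b).2, add_zero]⟩
      · rintro ⟨a, b⟩
        have := mi.2 v a
        have := mj.2 v a
        exact ⟨h1.2 ⟨a, by linarith⟩, h2.2 ⟨a, by linarith⟩⟩
    change (Δ.charts.map fi).left xi = (Δ.charts.map fj).left xj at hx
    set x : PrimeSpectrum (ChartRing k.1) := (Δ.charts.map fi).left xi with hxdef
    have h1 := (Δ.mem_range_charts_map_iff fi mi hi x).1 ⟨xi, rfl⟩
    have h2 := (Δ.mem_range_charts_map_iff fj mj hj x).1 ⟨xj, hx.symm⟩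
    obtain ⟨y, hy⟩ := (Δ.mem_range_charts_map_iff (fli ≫ fi) (mi + mj) hl x).2 (by
      have : (AddMonoidAlgebra.single (mi + mj) 1 : ChartRing k.1) =
          AddMonoidAlgebra.single mi 1 * AddMonoidAlgebra.single mj 1 := by
        rw [AddMonoidAlgebra.single_mul_single, one_mul]
      rw [this]
      exact fun h => (x.2.mem_or_mem h).elim h1 h2)
    refine ⟨l, fli, flj, y, ?_, ?_⟩
    · change (Δ.charts.map fli).left y = xi
      apply (Δ.charts.map fi).left.isOpenEmbedding.injective
      rw [← Scheme.Hom.comp_apply, ← Over.comp_left, ← Functor.map_comp]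
      exact hy
    · change (Δ.charts.map flj).left y = xj
      apply (Δ.charts.map fj).left.isOpenEmbedding.injective
      rw [← Scheme.Hom.comp_apply, ← Over.comp_left, ← Functor.map_comp,
        Subsingleton.elim (flj ≫ fj) (fli ≫ fi)]
      exact hy.trans hx

/-- The toric variety `X_Σ`, a scheme over `ℂ`: the colimit of (that is, the scheme glued from) the
affine charts `U_σ = Spec ℂ[σ^∨ ∩ M]`, where `U_τ` is embedded in `U_σ` as an open subscheme
whenever `τ` is a face of `σ`. -/
def Fan.variety {M : Type} [AddCommGroup M] (Δ : Fan M) : SchemeOverC :=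
  colimit Δ.charts

/-! ### The torus and its normalizer -/

/-- The torus `T = Hom(M, ℂ^*)`. -/
abbrev Torus (M : Type) [AddCommGroup M] : Type := Multiplicative M →* ℂˣ

/-- The algebra endomorphism `χ^m ↦ t(m) χ^m` of `ℂ[S_σ]`. -/
def chartRingTorus {M : Type} [AddCommGroup M] (t : Torus M) (σ : PointedCone ℝ (NReal M)) :
    ChartRing σ →ₐ[ℂ] ChartRing σ :=
  AddMonoidAlgebra.lift ℂ (ChartRing σ) (dualMonoid σ)
    { toFun := fun m => AddMonoidAlgebra.single m.toAdd
        (t (Multiplicative.ofAdd (m.toAdd : M)) : ℂ)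
      map_one' := by
        simp [AddMonoidAlgebra.one_def]
      map_mul' := fun a b => by
        simp [AddMonoidAlgebra.single_mul_single] }

theorem chartRingTorus_single {M : Type} [AddCommGroup M] (t : Torus M)
    (σ : PointedCone ℝ (NReal M)) (m : dualMonoid σ) (c : ℂ) :
    chartRingTorus t σ (AddMonoidAlgebra.single m c) =
      AddMonoidAlgebra.single m (c * t (Multiplicative.ofAdd (m : M))) := by
  simp [chartRingTorus]

/-- The action of a point of the torus on the diagram of charts. -/
def Fan.chartsTorus {M : Type} [AddCommGroup M] (Δ : Fan M) (t : Torus M) :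
    Δ.charts ⟶ Δ.charts where
  app σ := specCMap (chartRingTorus t σ.1)
  naturality τ σ f := by
    change specCMap _ ≫ specCMap _ = specCMap _ ≫ specCMap _
    rw [← specCMap_comp, ← specCMap_comp]
    congr 1
    apply chartRing_algHom_ext
    intro m
    simp [chartRingTorus_single]

/-- The action of the torus on the toric variety by endomorphisms. -/
def Fan.torusEnd {M : Type} [AddCommGroup M] (Δ : Fan M) : Torus M →* End Δ.variety where
  toFun t := colimMap (Δ.chartsTorus t)
  map_one' := by
    apply colimit.hom_ext
    intro σ
    rw [ι_colimMap]
    have : (Δ.chartsTorus 1).app σ = 𝟙 _ := by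
      refine Eq.trans ?_ (specCMap_id _)
      change specCMap _ = specCMap _
      congr 1
      apply chartRing_algHom_ext
      intro m
      simp [chartRingTorus_single]
    rw [this, Category.id_comp]
    exact (Category.comp_id _).symm
  map_mul' s t := by
    apply colimit.hom_ext
    intro σ
    have : (Δ.chartsTorus (s * t)).app σ = (Δ.chartsTorus t).app σ ≫ (Δ.chartsTorus s).app σ := by
      refine Eq.trans ?_ (specCMap_comp _ _)
      change specCMap _ = specCMap _
      congr 1
      apply chartRing_algHom_ext
      intro m
      simp [chartRingTorus_single]
    change _ = _ ≫ (colimMap _ ≫ colimMap _)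
    rw [ι_colimMap, ι_colimMap_assoc, ι_colimMap, this, Category.assoc]

/-- The action of the torus on the toric variety by automorphisms over `ℂ`. -/
def Fan.torusAction {M : Type} [AddCommGroup M] (Δ : Fan M) : Torus M →* Aut Δ.variety :=
  (Aut.unitsEndEquivAut Δ.variety).toMonoidHom.comp Δ.torusEnd.toHomUnits

/-- The torus `T`, as a subgroup of `Aut(X_Σ)`. -/
def Fan.torus {M : Type} [AddCommGroup M] (Δ : Fan M) : Subgroup (Aut Δ.variety) :=
  Δ.torusAction.range

/-- The normalizer `N(T)` of the torus in `Aut(X_Σ)`. -/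
abbrev Fan.torusNormalizer {M : Type} [AddCommGroup M] (Δ : Fan M) :
    Subgroup (Aut Δ.variety) :=
  Subgroup.normalizer (Δ.torus : Set (Aut Δ.variety))

/-- The group `W(X_Σ) = N(T) / T`. -/
abbrev Fan.weylGroup {M : Type} [AddCommGroup M] (Δ : Fan M) : Type :=
  Δ.torusNormalizer ⧸ Δ.torus.subgroupOf Δ.torusNormalizer

/-- The natural (left) action of `GL(M)` on `T = Hom(M, ℂ^*)`: `(γ t)(m) = t(γ⁻¹ m)`. -/
def torusTransport {M : Type} [AddCommGroup M] (γ : M ≃ₗ[ℤ] M) (t : Torus M) : Torus M :=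
  t.comp (AddMonoidHom.toMultiplicative (γ⁻¹ : M ≃ₗ[ℤ] M).toLinearMap.toAddMonoidHom)

/-! ### Symmetries of the fan -/

/-- The natural (left) action of `GL(M)` on `N_ℝ = Hom(M, ℝ)`: `(γ v)(m) = v(γ⁻¹ m)`. -/
def realAction {M : Type} [AddCommGroup M] (γ : M ≃ₗ[ℤ] M) : NReal M →ₗ[ℝ] NReal M where
  toFun v := v.comp (γ⁻¹ : M ≃ₗ[ℤ] M).toLinearMap
  map_add' _ _ := rfl
  map_smul' _ _ := rfl

/-- The group of all `γ ∈ GL(M)` with `γ(Σ) = Σ`, that is, such that `γ` maps the set of cones of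
`Σ` onto itself. -/
def Fan.symmetryGroup {M : Type} [AddCommGroup M] (Δ : Fan M) : Subgroup (M ≃ₗ[ℤ] M) where
  carrier := {γ | PointedCone.map (realAction γ) '' Δ.cones = Δ.cones}
  one_mem' := by
    have : PointedCone.map (realAction (1 : M ≃ₗ[ℤ] M)) = id := by
      funext σ; exact PointedCone.map_id σ
    simp [this]
  mul_mem' := fun {a b} ha hb => by
    have : PointedCone.map (realAction (a * b)) =
        PointedCone.map (realAction a) ∘ PointedCone.map (realAction b) := by
      funext σ; exact (PointedCone.map_map (realAction a) (realAction b) σ).symm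
    simp only [Set.mem_ofPred_eq] at ha hb ⊢
    rw [this, Set.image_comp, hb, ha]
  inv_mem' := fun {a} ha => by
    have : PointedCone.map (realAction a⁻¹) ∘ PointedCone.map (realAction a) = id := by
      funext σ
      refine (PointedCone.map_map (realAction a⁻¹) (realAction a) σ).trans ?_
      have : (realAction a⁻¹).comp (realAction a) = LinearMap.id := by
        ext v m
        simp [realAction]
      rw [this]; exact PointedCone.map_id σ
    simp only [Set.mem_ofPred_eq] at ha ⊢
    conv_lhs => rw [← ha]
    rw [← Set.image_comp, this, Set.image_id]

end Toric

end

noncomputable section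

namespace Toric

/-! ### The action of `GL(M)` on real vectors and cones -/

section

variable {M : Type} [AddCommGroup M]

/-! An automorphism g normalizing T permutes the T-stable open sets, and the charts U_σ can be
recognised among these by a topological property: V is a chart exactly when every cover of V by
T-stable open sets has a member containing V (`Fan.isStableIrreducible_chartSet`,
`Fan.IsStableIrreducible.exists_eq_chartSet`). So g permutes the charts, without any classification
of orbits, and it preserves the chart U_0 = Spec ℂ[M] of the zero cone, which lies in all the
others.

On U_0, g is an automorphism φ of ℂ[M] that carries T-eigenvectors to T-eigenvectors, because
conjugation by g only replaces t by another point of T. The eigenvectors are the monomials up to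
scalars, so φ(χ^m) = c(m) χ^{α(m)} with α in `GL(M)` and c in T (`Fan.exists_monomialHom_bot`).
Every chart ring embeds in ℂ[M], so the same formula describes g on all charts, and g(U_σ) = U_τ
means that α m lies in S_σ exactly when m lies in S_τ (`Fan.exists_monomialHom`). A regular cone is
recovered from its dual monoid, hence α maps τ onto σ and is a symmetry of Σ. Conjugation by g acts
on T through γ = α⁻¹ (`Fan.induces_of_monomialHom`).

Since T acts faithfully and separates characters, γ is determined by g, so g ↦ γ is a homomorphism.
It is surjective because a symmetry permutes the charts compatibly with gluing (`Fan.symmetryAut`).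
Its kernel is T: if α = 1, then g is χ^m ↦ c(m) χ^m on every chart, the action of c
(`Fan.Induces.mem_torus`).

Finiteness is separate: the symmetry group acts on the finite set of cones, faithfully because an
element of `GL(M)` preserving a ray must fix its primitive generator (`Fan.eq_one_of_map_eq`). -/

theorem toReal_apply (n : Module.Dual ℤ M) (m : M) : toReal n m = (n m : ℝ) := rfl

theorem toReal_mem_latticeCone {s : Set (Module.Dual ℤ M)} {n : Module.Dual ℤ M} (h : n ∈ s) :
    toReal n ∈ latticeCone s :=
  PointedCone.subset_hull ⟨n, h, rfl⟩

theorem realAction_apply (γ : M ≃ₗ[ℤ] M) (v : NReal M) (m : M) :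
    realAction γ v m = v (γ⁻¹ m) := rfl

theorem realAction_toReal (γ : M ≃ₗ[ℤ] M) (n : Module.Dual ℤ M) :
    realAction γ (toReal n) = toReal (n.comp (γ⁻¹ : M ≃ₗ[ℤ] M).toLinearMap) := rfl

theorem realAction_inv_cancel (γ : M ≃ₗ[ℤ] M) (v : NReal M) :
    realAction γ⁻¹ (realAction γ v) = v := by
  ext m
  simp [realAction_apply]

theorem map_realAction_mul (γ δ : M ≃ₗ[ℤ] M) (σ : PointedCone ℝ (NReal M)) :
    PointedCone.map (realAction (γ * δ)) σ =
      PointedCone.map (realAction γ) (PointedCone.map (realAction δ) σ) :=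
  (PointedCone.map_map (realAction γ) (realAction δ) σ).symm

theorem map_realAction_one (σ : PointedCone ℝ (NReal M)) :
    PointedCone.map (realAction (1 : M ≃ₗ[ℤ] M)) σ = σ :=
  PointedCone.map_id σ

theorem Fan.map_realAction_mem (Δ : Fan M) {γ : M ≃ₗ[ℤ] M} (hγ : γ ∈ Δ.symmetryGroup)
    {σ : PointedCone ℝ (NReal M)} (hσ : σ ∈ Δ.cones) :
    PointedCone.map (realAction γ) σ ∈ Δ.cones := by
  have : PointedCone.map (realAction γ) '' Δ.cones = Δ.cones := hγ
  exact this.subset ⟨σ, hσ, rfl⟩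

/-! ### Cones generated by part of a basis, in dual coordinates -/

section DualBasis

variable {ι : Type} [Fintype ι] [DecidableEq ι]

/-- Every basis of the dual lattice is dual to a basis of the lattice. -/
theorem exists_dual_basis [Module.Free ℤ M] [Module.Finite ℤ M] (b : Module.Basis ι ℤ (Module.Dual ℤ M)) :
    ∃ c : Module.Basis ι ℤ M, ∀ i j, b i (c j) = if i = j then 1 else 0 := by
  -- The basis dual to b lives in the double dual; reflexivity of M brings it back to M.
  refine ⟨b.dualBasis.map (Module.evalEquiv ℤ M).symm, fun i j => ?_⟩
  rw [Module.Basis.map_apply]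
  have : ∀ x : Module.Dual ℤ (Module.Dual ℤ M), ∀ f : Module.Dual ℤ M,
      f ((Module.evalEquiv ℤ M).symm x) = x f := by
    intro x f
    simp
  rw [this, Module.Basis.dualBasis_apply_self]

variable (b : Module.Basis ι ℤ (Module.Dual ℤ M)) (c : Module.Basis ι ℤ M)
  (hbc : ∀ i j, b i (c j) = if i = j then 1 else 0)

include hbc

theorem NReal.eq_sum_dual_basis (v : NReal M) : v = ∑ i, v (c i) • toReal (b i) := by
  apply c.ext
  intro j
  simp [LinearMap.sum_apply, toReal_apply, hbc]

/-- The cone generated by a part of a basis, in terms of the dual coordinates. -/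
theorem mem_latticeCone_basis (s : Set ι) (v : NReal M) :
    v ∈ latticeCone (b '' s) ↔ (∀ i, 0 ≤ v (c i)) ∧ ∀ i, i ∉ s → v (c i) = 0 := by
  constructor
  · intro hv
    induction hv using Submodule.span_induction with
    | mem x hx =>
      obtain ⟨_, ⟨i, hi, rfl⟩, rfl⟩ := hx
      refine ⟨fun j => ?_, fun j hj => ?_⟩
      · rw [toReal_apply, hbc]; split_ifs <;> simp
      · rw [toReal_apply, hbc, if_neg (ne_of_mem_of_not_mem hi hj)]; simp
    | zero => simp
    | add x y _ _ hx hy =>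
      refine ⟨fun j => add_nonneg (hx.1 j) (hy.1 j), fun j hj => ?_⟩
      rw [LinearMap.add_apply, hx.2 j hj, hy.2 j hj, add_zero]
    | smul a x _ hx =>
      refine ⟨fun j => mul_nonneg a.2 (hx.1 j), fun j hj => ?_⟩
      change (a : ℝ) * x (c j) = 0
      rw [hx.2 j hj, mul_zero]
  · rintro ⟨h0, h1⟩
    rw [NReal.eq_sum_dual_basis b c hbc v]
    refine Submodule.sum_mem _ fun i _ => ?_
    by_cases hi : i ∈ s
    · exact Submodule.smul_mem _ (⟨_, h0 i⟩ : {r : ℝ // 0 ≤ r})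
        (toReal_mem_latticeCone ⟨i, hi, rfl⟩)
    · rw [h1 i hi, zero_smul]
      exact Submodule.zero_mem _

/-- The part of a basis generating a regular cone can be shrunk to get a face. -/
theorem isFace_latticeCone_basis {s t : Set ι} (hts : t ⊆ s) :
    IsFace (latticeCone (b '' t)) (latticeCone (b '' s)) := by
  classical
  have key : ∀ v : NReal M, v (∑ i ∈ Finset.univ.filter (· ∉ t), c i) =
      ∑ i ∈ Finset.univ.filter (· ∉ t), v (c i) := fun v => map_sum _ _ _
  -- The supporting functional adds up the coordinates outside t. These are nonnegative on the cone,
  -- so the sum vanishes only where each of them does.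
  refine ⟨∑ i ∈ Finset.univ.filter (· ∉ t), c i, fun v hv => ?_, fun v => ?_⟩
  · rw [key]
    exact Finset.sum_nonneg fun i _ => ((mem_latticeCone_basis b c hbc s v).1 hv).1 i
  · rw [key, mem_latticeCone_basis b c hbc, mem_latticeCone_basis b c hbc]
    constructor
    · rintro ⟨h0, h1⟩
      exact ⟨⟨h0, fun i hi => h1 i (fun h => hi (hts h))⟩,
        Finset.sum_eq_zero fun i hi => h1 i (Finset.mem_filter.1 hi).2⟩
    · rintro ⟨⟨h0, -⟩, h2⟩
      rw [Finset.sum_eq_zero_iff_of_nonneg fun i _ => h0 i] at h2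
      exact ⟨h0, fun i hi => h2 i (by simp [hi])⟩

end DualBasis

/-! ### Regular cones and finiteness of the symmetry group -/

section Regular

variable [Module.Free ℤ M] [Module.Finite ℤ M]

/-- A regular cone is the dual of its dual monoid. -/
theorem IsRegularCone.mem_iff {σ : PointedCone ℝ (NReal M)} (hσ : IsRegularCone σ)
    (v : NReal M) : v ∈ σ ↔ ∀ m ∈ dualMonoid σ, 0 ≤ v m := by
  refine ⟨fun hv m hm => hm v hv, fun h => ?_⟩
  obtain ⟨b, s, rfl⟩ := hσ
  obtain ⟨c, hbc⟩ := exists_dual_basis b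
  rw [mem_latticeCone_basis b c hbc]
  refine ⟨fun i => h _ fun w hw => ((mem_latticeCone_basis b c hbc s w).1 hw).1 i,
    fun i hi => le_antisymm ?_ (h _ fun w hw => ((mem_latticeCone_basis b c hbc s w).1 hw).1 i)⟩
  -- For i outside s the coordinate c i vanishes on the cone, so its negative is in the dual monoid
  -- too and forces v (c i) ≤ 0.
  have := h (-(c i)) fun w hw => by
    rw [map_neg, ((mem_latticeCone_basis b c hbc s w).1 hw).2 i hi, neg_zero]
  rw [map_neg] at this
  linarith

/-- Completeness only serves to provide some cone; the empty part of its basis generates the zero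
face. The zero cone gives the open orbit Spec ℂ[M], on which all later computations take place. -/
theorem Fan.bot_mem (Δ : Fan M) (hc : Δ.IsComplete) (hr : Δ.IsRegular) : ⊥ ∈ Δ.cones := by
  obtain ⟨σ, hσ, -⟩ := hc 0
  obtain ⟨b, s, h⟩ := hr σ hσ
  obtain ⟨c, hbc⟩ := exists_dual_basis b
  have := Δ.face_mem σ hσ _ (h ▸ isFace_latticeCone_basis b c hbc (Set.empty_subset s))
  simpa [latticeCone] using this

/-- An element of `GL(M)` that fixes every cone of a complete regular fan is the identity. -/
theorem Fan.eq_one_of_map_eq (Δ : Fan M) (hc : Δ.IsComplete) (hr : Δ.IsRegular)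
    (γ : M ≃ₗ[ℤ] M) (h : ∀ σ ∈ Δ.cones, PointedCone.map (realAction γ) σ = σ) : γ = 1 := by
  have hfix : ∀ v : NReal M, realAction γ v = v := by
    intro v
    obtain ⟨σ, hσ, hv⟩ := hc v
    obtain ⟨b, s, rfl⟩ := hr σ hσ
    obtain ⟨c, hbc⟩ := exists_dual_basis b
    -- The ray through b i is a face, hence a cone of the fan, hence preserved by γ.
    have hgen : ∀ i ∈ s, realAction γ (toReal (b i)) = toReal (b i) := by
      intro i hi
      have hτ := Δ.face_mem _ hσ _
        (isFace_latticeCone_basis b c hbc (Set.singleton_subset_iff.2 hi))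
      have hmap := h _ hτ
      have hmem : toReal (b i) ∈ latticeCone (b '' {i}) := toReal_mem_latticeCone ⟨i, rfl, rfl⟩
      have h1 : realAction γ (toReal (b i)) ∈ latticeCone (b '' {i}) := by
        rw [← hmap]; exact ⟨_, hmem, rfl⟩
      obtain ⟨w, hw, hwb⟩ : ∃ w ∈ latticeCone (b '' {i}), realAction γ w = toReal (b i) := by
        have := hmem
        rw [← hmap] at this
        exact this
      have line : ∀ u ∈ latticeCone (b '' {i}), u = u (c i) • toReal (b i) := by
        intro u hu
        apply c.ext
        intro j
        change u (c j) = u (c i) * toReal (b i) (c j)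
        by_cases hij : i = j
        · subst hij; simp [toReal_apply, hbc]
        · rw [((mem_latticeCone_basis b c hbc _ u).1 hu).2 j (fun h => hij h.symm),
            toReal_apply, hbc, if_neg hij]
          simp
      have e1 := line _ h1
      have e2 := line _ hw
      have p1 := ((mem_latticeCone_basis b c hbc _ _).1 h1).1 i
      rw [realAction_toReal, toReal_apply] at p1
      rw [realAction_toReal, toReal_apply] at e1
      -- γ multiplies b i by a, and γ⁻¹ multiplies it by the d below. Both are integers because γ
      -- preserves the lattice; as d a = 1 and a ≥ 0, a = 1.
      set a : ℤ := (b i).comp (γ⁻¹ : M ≃ₗ[ℤ] M).toLinearMap (c i) with ha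
      have hwi : w = realAction γ⁻¹ (toReal (b i)) := by rw [← hwb, realAction_inv_cancel]
      rw [hwi, realAction_toReal, toReal_apply] at e2
      set d : ℤ := (b i).comp (γ⁻¹⁻¹ : M ≃ₗ[ℤ] M).toLinearMap (c i) with hd
      have e3 : toReal (b i) = (d : ℝ) • (a : ℝ) • toReal (b i) := by
        conv_lhs => rw [← hwb, hwi, realAction_toReal, e2, map_smul, realAction_toReal, e1]
      have e4 : (1 : ℝ) = d * a := by
        have := LinearMap.congr_fun e3 (c i)
        change toReal (b i) (c i) = (d : ℝ) * ((a : ℝ) * toReal (b i) (c i)) at this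
        simpa [toReal_apply, hbc] using this
      have e5 : d * a = 1 := by exact_mod_cast e4.symm
      have ha0 : 0 ≤ a := by exact_mod_cast p1
      have : a = 1 := by
        rcases Int.eq_one_or_neg_one_of_mul_eq_one (by rw [mul_comm]; exact e5) with h | h <;> omega
      rw [realAction_toReal, e1, this]
      simp
    induction hv using Submodule.span_induction with
    | mem x hx =>
      obtain ⟨_, ⟨i, hi, rfl⟩, rfl⟩ := hx
      exact hgen i hi
    | zero => simp
    | add x y _ _ hx hy => rw [map_add, hx, hy]
    | smul a x _ hx =>
      have : a • x = (a : ℝ) • x := rfl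
      rw [this, map_smul, hx]
  have hdual : ∀ (n : Module.Dual ℤ M) (m : M), n (γ⁻¹ m) = n m := by
    intro n m
    have := LinearMap.congr_fun (hfix (toReal n)) m
    rw [realAction_apply, toReal_apply, toReal_apply] at this
    exact_mod_cast this
  have : γ⁻¹ = 1 := by
    ext m
    refine (Module.Free.chooseBasis ℤ M).ext_elem fun i => ?_
    exact hdual ((Module.Free.chooseBasis ℤ M).coord i) m
  exact inv_eq_one.1 this

/-- The symmetry group of a complete regular fan is finite. -/
theorem Fan.finite_symmetryGroup (Δ : Fan M) (hc : Δ.IsComplete) (hr : Δ.IsRegular) :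
    Finite Δ.symmetryGroup := by
  have := Δ.finite.to_subtype
  -- Symmetries embed in the finite set of self-maps of the set of cones.
  let f : Δ.symmetryGroup → (Δ.Cone → Δ.Cone) := fun γ σ =>
    ⟨PointedCone.map (realAction γ.1) σ.1, Δ.map_realAction_mem γ.2 σ.2⟩
  refine Finite.of_injective f fun γ δ h => ?_
  have : δ⁻¹ * γ = 1 := by
    apply Subtype.ext
    refine Δ.eq_one_of_map_eq hc hr _ fun σ hσ => ?_
    have h1 : PointedCone.map (realAction γ.1) σ = PointedCone.map (realAction δ.1) σ :=
      congrArg Subtype.val (congrFun h ⟨σ, hσ⟩)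
    change PointedCone.map (realAction ((δ.1)⁻¹ * γ.1)) σ = σ
    rw [map_realAction_mul, h1, ← map_realAction_mul, inv_mul_cancel, map_realAction_one]
  exact (inv_mul_eq_one.1 this).symm

end Regular

end

/-! ### Characters and weight vectors of the torus -/

section

variable {M : Type} [AddCommGroup M]

section Characters

variable [Module.Free ℤ M]

/-- The points of the torus separate the characters. -/
theorem eq_of_forall_torus {m n : M}
    (h : ∀ t : Torus M, t (Multiplicative.ofAdd m) = t (Multiplicative.ofAdd n)) : m = n := by
  refine (Module.Free.chooseBasis ℤ M).ext_elem fun i => ?_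
  have two : (2 : ℂ) ≠ 0 := two_ne_zero
  -- The test point is m ↦ 2 ^ mᵢ, which recovers the coordinate mᵢ because powers of 2 are
  -- distinct.
  have := h ((zpowersHom ℂˣ (Units.mk0 2 two)).comp
    (AddMonoidHom.toMultiplicative ((Module.Free.chooseBasis ℤ M).coord i).toAddMonoidHom))
  have h2 := congrArg (fun u : ℂˣ => ‖(u : ℂ)‖) this
  simp only [MonoidHom.comp_apply, zpowersHom_apply, Units.val_zpow_eq_zpow_val, Units.val_mk0,
    norm_zpow, Complex.norm_ofNat] at h2
  exact zpow_right_injective₀ two_pos (by norm_num) h2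

/-- Dedekind's independence of characters: evaluations at elements of M are pairwise distinct
homomorphisms from T to ℂ. -/
theorem linearIndependent_torus_characters :
    LinearIndependent ℂ (fun (m : M) (t : Torus M) => (t (Multiplicative.ofAdd m) : ℂ)) := by
  let e : M → (Torus M →* ℂ) := fun m =>
    { toFun := fun t => (t (Multiplicative.ofAdd m) : ℂ)
      map_one' := rfl
      map_mul' := fun _ _ => rfl }
  have he : Function.Injective e := fun m n h =>
    eq_of_forall_torus fun t => Units.ext (DFunLike.congr_fun h t)
  exact (linearIndependent_monoidHom (Torus M) ℂ).comp e he

end Characters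

theorem coeff_chartRingTorus (t : Torus M) (σ : PointedCone ℝ (NReal M)) (f : ChartRing σ)
    (m : dualMonoid σ) :
    (chartRingTorus t σ f).coeff m = f.coeff m * t (Multiplicative.ofAdd (m : M)) := by
  classical
  induction f using AddMonoidAlgebra.induction_linear with
  | zero => simp
  | add x y hx hy => simp [hx, hy, add_mul]
  | single n c =>
    rw [chartRingTorus_single, AddMonoidAlgebra.coeff_single, AddMonoidAlgebra.coeff_single]
    by_cases h : n = m
    · subst h; simp
    · rw [Finsupp.single_eq_of_ne (Ne.symm h), Finsupp.single_eq_of_ne (Ne.symm h), zero_mul]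

/-- A linear subspace of `ℂ[S_σ]` that is stable under the torus contains the homogeneous
components of its elements. -/
theorem single_mem_of_torus_stable [Module.Free ℤ M] {σ : PointedCone ℝ (NReal M)}
    (I : Submodule ℂ (ChartRing σ)) (hI : ∀ (t : Torus M), ∀ f ∈ I, chartRingTorus t σ f ∈ I)
    {f : ChartRing σ} (hf : f ∈ I) (m : dualMonoid σ) :
    AddMonoidAlgebra.single m (f.coeff m) ∈ I := by
  by_contra hm
  -- A functional l killing I but not the component at m. Applied to all translates t f, it yields a
  -- linear relation between characters, whose coefficient at m must then vanish.
  obtain ⟨l, hl, hIl⟩ := I.exists_le_ker_of_notMem hm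
  have hsum : ∀ t : Torus M, ∑ n ∈ f.coeff.support,
      l (AddMonoidAlgebra.single n (f.coeff n)) * (t (Multiplicative.ofAdd (n : M)) : ℂ) = 0 := by
    intro t
    have h0 : l (chartRingTorus t σ f) = 0 := hIl (hI t f hf)
    have h1 : f = ∑ n ∈ f.coeff.support, AddMonoidAlgebra.single n (f.coeff n) := by
      apply AddMonoidAlgebra.coeff_injective
      rw [AddMonoidAlgebra.coeff_sum]
      exact (Finsupp.sum_single f.coeff).symm
    conv_lhs at h0 => rw [h1]
    rw [map_sum, map_sum] at h0
    rw [← h0]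
    refine Finset.sum_congr rfl fun n _ => ?_
    rw [chartRingTorus_single, mul_comm, mul_comm (f.coeff n), ← smul_eq_mul, ← smul_eq_mul,
      ← map_smul]
    simp
  have hind := (linearIndependent_torus_characters (M := M)).comp
    ((↑) : dualMonoid σ → M) Subtype.val_injective
  rw [linearIndependent_iff'] at hind
  have := hind f.coeff.support (fun n => l (AddMonoidAlgebra.single n (f.coeff n))) (by
    ext t
    simpa [Finset.sum_apply] using hsum t) m
  by_cases hmem : m ∈ f.coeff.support
  · exact hl (this hmem)
  · rw [Finsupp.notMem_support_iff] at hmem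
    rw [hmem, AddMonoidAlgebra.single_zero] at hm
    exact hm I.zero_mem

/-- An eigenvector of the torus in `ℂ[S_σ]` is a monomial. -/
theorem exists_eq_single_of_eigenvector [Module.Free ℤ M] {σ : PointedCone ℝ (NReal M)}
    {f : ChartRing σ} (hf : f ≠ 0) (χ : Torus M → ℂ)
    (h : ∀ t, chartRingTorus t σ f = χ t • f) :
    ∃ (m : dualMonoid σ) (c : ℂˣ), f = AddMonoidAlgebra.single m (c : ℂ) ∧
      ∀ t : Torus M, (t (Multiplicative.ofAdd (m : M)) : ℂ) = χ t := by
  have key : ∀ m ∈ f.coeff.support, ∀ t : Torus M,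
      (t (Multiplicative.ofAdd (m : M)) : ℂ) = χ t := by
    intro m hm t
    have h1 := congrArg (fun g : ChartRing σ => g.coeff m) (h t)
    simp only [coeff_chartRingTorus, AddMonoidAlgebra.coeff_smul, Finsupp.smul_apply,
      smul_eq_mul] at h1
    rw [mul_comm] at h1
    exact mul_right_cancel₀ (Finsupp.mem_support_iff.1 hm) h1
  have hne : f.coeff.support.Nonempty := by
    rw [Finsupp.support_nonempty_iff]
    simpa using hf
  obtain ⟨m, hm⟩ := hne
  refine ⟨m, Units.mk0 _ (Finsupp.mem_support_iff.1 hm), ?_, key m hm⟩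
  apply AddMonoidAlgebra.coeff_injective
  ext n
  rw [AddMonoidAlgebra.coeff_single]
  by_cases hn : m = n
  · subst hn; simp
  · rw [Finsupp.single_eq_of_ne (Ne.symm hn)]
    by_contra h0
    refine hn (Subtype.ext (eq_of_forall_torus fun t => Units.ext ?_))
    rw [key m hm, key n (Finsupp.mem_support_iff.2 h0)]

theorem chartRingMap_injective {τ σ : PointedCone ℝ (NReal M)} (h : τ ≤ σ) :
    Function.Injective (chartRingMap h) :=
  AddMonoidAlgebra.mapDomain_injective (AddSubmonoid.inclusion_injective _)

section SpecC

variable {A B : Type} [CommRing A] [Algebra ℂ A] [CommRing B] [Algebra ℂ B]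

theorem specCMap_injective : Function.Injective (specCMap (A := A) (B := B)) := by
  intro f g h
  have h1 := congrArg Over.Hom.left h
  have h2 := Spec.map_injective h1
  ext x
  exact congrArg (fun φ => φ.hom x) h2

/-- Fullness of `Spec` gives a ring homomorphism; compatibility with the structure maps to Spec ℂ
makes it ℂ-linear. -/
theorem specCMap_surjective : Function.Surjective (specCMap (A := A) (B := B)) := by
  intro h
  have hw : h.left ≫ Spec.map (CommRingCat.ofHom (algebraMap ℂ A)) =
    Spec.map (CommRingCat.ofHom (algebraMap ℂ B)) := Over.w h
  obtain ⟨φ, hφ⟩ := Spec.map_surjective h.left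
  rw [← hφ] at hw
  have hw' := Spec.map_injective ((Spec.map_comp _ _).trans hw)
  refine ⟨{ φ.hom with commutes' := fun r => congrArg (fun ψ => ψ.hom r) hw' }, ?_⟩
  apply Over.OverMorphism.ext
  exact hφ

end SpecC

end

section

variable {M : Type} [AddCommGroup M] (Δ : Fan M)

/-! ### The charts of the toric variety -/

/-- The inclusion of an affine chart in the toric variety. -/
def Fan.chartι (σ : Δ.Cone) : specC (ChartRing σ.1) ⟶ Δ.variety :=
  colimit.ι Δ.charts σ

theorem Fan.variety_hom_ext {Y : SchemeOverC} {f g : Δ.variety ⟶ Y}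
    (h : ∀ σ, Δ.chartι σ ≫ f = Δ.chartι σ ≫ g) : f = g :=
  colimit.hom_ext h

theorem Fan.chartι_w {τ σ : Δ.Cone} (h : τ.1 ≤ σ.1) :
    specCMap (chartRingMap h) ≫ Δ.chartι σ = Δ.chartι τ :=
  colimit.w Δ.charts (homOfLE h)

instance Fan.charts_forget_isOpenImmersion {τ σ : Δ.Cone} (f : τ ⟶ σ) :
    IsOpenImmersion ((Δ.charts ⋙ Over.forget _).map f) :=
  Δ.charts_isOpenImmersion f

instance Fan.charts_forget_isLocallyDirected :
    ((Δ.charts ⋙ Over.forget _) ⋙ Scheme.forget).IsLocallyDirected :=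
  Δ.charts_isLocallyDirected

/-- The forgetful functor to schemes preserves colimits. This transfers the results on gluing
schemes along open immersions to the colimit over ℂ. -/
theorem Fan.exists_chartι_left_eq :
    ∃ e : colimit (Δ.charts ⋙ Over.forget _) ≅ Δ.variety.left,
      ∀ σ, colimit.ι (Δ.charts ⋙ Over.forget _) σ ≫ e.hom = (Δ.chartι σ).left :=
  ⟨(colimit.isColimit _).coconePointUniqueUpToIso
    (isColimitOfPreserves (Over.forget _) (colimit.isColimit Δ.charts)),
    fun σ => IsColimit.comp_coconePointUniqueUpToIso_hom _ _ σ⟩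

instance Fan.chartι_isOpenImmersion (σ : Δ.Cone) : IsOpenImmersion (Δ.chartι σ).left := by
  obtain ⟨e, he⟩ := Δ.exists_chartι_left_eq
  rw [← he]
  exact IsOpenImmersion.comp (colimit.ι (Δ.charts ⋙ Over.forget _) σ) e.hom

theorem Fan.exists_chartι_eq (x : Δ.variety.left) : ∃ σ y, (Δ.chartι σ).left y = x := by
  obtain ⟨e, he⟩ := Δ.exists_chartι_left_eq
  obtain ⟨σ, y, hy⟩ := Scheme.IsLocallyDirected.ι_jointly_surjective _ (e.inv x)
  refine ⟨σ, y, ?_⟩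
  have h1 : (Δ.chartι σ).left y = e.hom (colimit.ι (Δ.charts ⋙ Over.forget _) σ y) := by
    rw [← he]; rfl
  rw [h1, hy, ← Scheme.Hom.comp_apply, e.inv_hom_id]
  rfl

instance Fan.chartι_mono (σ : Δ.Cone) : Mono (Δ.chartι σ) :=
  (Over.forget _).mono_of_mono_map (inferInstanceAs (Mono (Δ.chartι σ).left))

theorem Fan.chartι_torusAction (σ : Δ.Cone) (t : Torus M) :
    Δ.chartι σ ≫ (Δ.torusAction t).hom = specCMap (chartRingTorus t σ.1) ≫ Δ.chartι σ :=
  ι_colimMap (Δ.chartsTorus t) σ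

/-- The set of points of the chart `U_σ`. -/
def Fan.chartSet (σ : Δ.Cone) : Set Δ.variety.left := Set.range (Δ.chartι σ).left

theorem Fan.isOpen_chartSet (σ : Δ.Cone) : IsOpen (Δ.chartSet σ) :=
  (Δ.chartι σ).left.isOpenEmbedding.isOpen_range

theorem Fan.chartSet_mono {τ σ : Δ.Cone} (h : τ.1 ≤ σ.1) : Δ.chartSet τ ⊆ Δ.chartSet σ := by
  rintro _ ⟨y, rfl⟩
  refine ⟨(specCMap (chartRingMap h)).left y, ?_⟩
  rw [← Scheme.Hom.comp_apply, ← Over.comp_left, Δ.chartι_w h]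

/-! ### The action of automorphisms on points -/

/-- The action of an automorphism of the toric variety on its points. -/
def Fan.pointMap (g : Aut Δ.variety) : Δ.variety.left → Δ.variety.left := g.hom.left

theorem Fan.continuous_pointMap (g : Aut Δ.variety) : Continuous (Δ.pointMap g) :=
  g.hom.left.continuous

theorem Fan.pointMap_mul (g h : Aut Δ.variety) (x : Δ.variety.left) :
    Δ.pointMap (g * h) x = Δ.pointMap g (Δ.pointMap h x) :=
  Scheme.Hom.comp_apply h.hom.left g.hom.left x

theorem Fan.pointMap_one (x : Δ.variety.left) : Δ.pointMap 1 x = x := rfl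

theorem Fan.pointMap_inv_pointMap (g : Aut Δ.variety) (x : Δ.variety.left) :
    Δ.pointMap g⁻¹ (Δ.pointMap g x) = x := by
  rw [← pointMap_mul, inv_mul_cancel, pointMap_one]

theorem Fan.pointMap_pointMap_inv (g : Aut Δ.variety) (x : Δ.variety.left) :
    Δ.pointMap g (Δ.pointMap g⁻¹ x) = x := by
  rw [← pointMap_mul, mul_inv_cancel, pointMap_one]

theorem Fan.pointMap_torusAction_chartι (t : Torus M) (σ : Δ.Cone)
    (y : (specC (ChartRing σ.1)).left) :
    Δ.pointMap (Δ.torusAction t) ((Δ.chartι σ).left y) =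
      (Δ.chartι σ).left ((specCMap (chartRingTorus t σ.1)).left y) := by
  have := congrArg (fun f => f.left y) (Δ.chartι_torusAction σ t)
  simp only [Over.comp_left, Scheme.Hom.comp_apply] at this
  exact this

/-- A torus-stable open set of points of the toric variety. -/
structure Fan.IsStableOpen (V : Set Δ.variety.left) : Prop where
  isOpen : IsOpen V
  stable : ∀ t, Δ.pointMap (Δ.torusAction t) ⁻¹' V = V

/-- A torus-stable open set that is not covered by torus-stable open sets not containing it. -/
structure Fan.IsStableIrreducible (V : Set Δ.variety.left) : Prop extends Δ.IsStableOpen V where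
  exists_subset : ∀ 𝒱 : Set (Set Δ.variety.left), (∀ W ∈ 𝒱, Δ.IsStableOpen W) → V ⊆ ⋃₀ 𝒱 →
    ∃ W ∈ 𝒱, V ⊆ W

variable {Δ}

theorem Fan.exists_torusAction_mul_eq {g : Aut Δ.variety} (hg : g ∈ Δ.torusNormalizer)
    (t : Torus M) : ∃ t', g * Δ.torusAction t = Δ.torusAction t' * g := by
  have h1 : Δ.torusAction t ∈ (Δ.torus : Set (Aut Δ.variety)) := ⟨t, rfl⟩
  obtain ⟨t', ht'⟩ := (Subgroup.mem_normalizer_iff.1 hg _).1 h1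
  exact ⟨t', by rw [ht']; group⟩

theorem Fan.IsStableOpen.preimage {V : Set Δ.variety.left} (hV : Δ.IsStableOpen V)
    {g : Aut Δ.variety} (hg : g ∈ Δ.torusNormalizer) :
    Δ.IsStableOpen (Δ.pointMap g ⁻¹' V) where
  isOpen := hV.isOpen.preimage (Δ.continuous_pointMap g)
  stable t := by
    obtain ⟨t', ht'⟩ := exists_torusAction_mul_eq hg t
    ext x
    change Δ.pointMap g (Δ.pointMap (Δ.torusAction t) x) ∈ V ↔ Δ.pointMap g x ∈ V
    rw [← pointMap_mul, ht', pointMap_mul]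
    exact Set.ext_iff.1 (hV.stable t') _

theorem Fan.IsStableIrreducible.preimage {V : Set Δ.variety.left} (hV : Δ.IsStableIrreducible V)
    {g : Aut Δ.variety} (hg : g ∈ Δ.torusNormalizer) :
    Δ.IsStableIrreducible (Δ.pointMap g ⁻¹' V) where
  toIsStableOpen := hV.toIsStableOpen.preimage hg
  exists_subset 𝒱 h𝒱 hsub := by
    -- A stable cover of the preimage is carried by g to a stable cover of V.
    obtain ⟨_, ⟨W, hW, rfl⟩, hVW⟩ := hV.exists_subset ((Δ.pointMap g⁻¹ ⁻¹' ·) '' 𝒱)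
      (by rintro _ ⟨W, hW, rfl⟩; exact (h𝒱 W hW).preimage (inv_mem hg))
      (fun x hx => by
        obtain ⟨W, hW, hxW⟩ := hsub (show Δ.pointMap g⁻¹ x ∈ _ by
          rwa [Set.mem_preimage, pointMap_pointMap_inv])
        exact ⟨_, ⟨W, hW, rfl⟩, hxW⟩)
    refine ⟨W, hW, fun x hx => ?_⟩
    have := hVW hx
    rwa [Set.mem_preimage, pointMap_inv_pointMap] at this

theorem Fan.isStableOpen_chartSet (σ : Δ.Cone) : Δ.IsStableOpen (Δ.chartSet σ) where
  isOpen := Δ.isOpen_chartSet σ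
  stable t := by
    have key : ∀ t x, x ∈ Δ.chartSet σ → Δ.pointMap (Δ.torusAction t) x ∈ Δ.chartSet σ := by
      rintro t _ ⟨y, rfl⟩
      exact ⟨_, (Δ.pointMap_torusAction_chartι t σ y).symm⟩
    refine Set.Subset.antisymm (fun x hx => ?_) (key t)
    have := key t⁻¹ _ hx
    have ht : t⁻¹ * t = 1 := inv_mul_cancel t
    rwa [← pointMap_mul, ← map_mul, ht, map_one, pointMap_one] at this

/-! ### The ideal of the complement of a stable open set in a chart -/

/-- The ideal in `ℂ[S_σ]` of the complement of a set of points of the toric variety. -/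
def Fan.complIdeal (σ : Δ.Cone) (V : Set Δ.variety.left) : Ideal (ChartRing σ.1) :=
  PrimeSpectrum.vanishingIdeal {y | (Δ.chartι σ).left y ∉ V}

/-- The complement of V in the chart is closed, so it is the zero locus of its vanishing ideal. -/
theorem Fan.complIdeal_le_iff {σ : Δ.Cone} {V : Set Δ.variety.left} (hV : IsOpen V)
    (y : PrimeSpectrum (ChartRing σ.1)) :
    complIdeal σ V ≤ y.asIdeal ↔ (Δ.chartι σ).left y ∉ V := by
  have hclosed : IsClosed {y : PrimeSpectrum (ChartRing σ.1) | (Δ.chartι σ).left y ∉ V} :=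
    (hV.preimage (Δ.chartι σ).left.continuous).isClosed_compl
  have := PrimeSpectrum.zeroLocus_vanishingIdeal_eq_closure
    {y : PrimeSpectrum (ChartRing σ.1) | (Δ.chartι σ).left y ∉ V}
  rw [hclosed.closure_eq] at this
  exact Set.ext_iff.1 this y

theorem Fan.chartSet_subset_of_complIdeal_eq_top {σ : Δ.Cone} {V : Set Δ.variety.left}
    (h : complIdeal σ V = ⊤) : Δ.chartSet σ ⊆ V := by
  rintro _ ⟨y, rfl⟩
  by_contra hy
  have : y ∈ ({y | (Δ.chartι σ).left y ∉ V} : Set (PrimeSpectrum (ChartRing σ.1))) := hy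
  rw [PrimeSpectrum.vanishingIdeal_eq_top_iff.1 h] at this
  exact this

/-- The ideal inherits torus-stability from V, hence it is M-graded. -/
theorem Fan.single_mem_complIdeal [Module.Free ℤ M] {σ : Δ.Cone} {V : Set Δ.variety.left}
    (hV : Δ.IsStableOpen V) {f : ChartRing σ.1} (hf : f ∈ complIdeal σ V) (m : dualMonoid σ.1) :
    AddMonoidAlgebra.single m (f.coeff m) ∈ complIdeal σ V := by
  refine single_mem_of_torus_stable ((complIdeal σ V).restrictScalars ℂ) (fun t f hf => ?_) hf m
  rw [Submodule.restrictScalars_mem, complIdeal, PrimeSpectrum.mem_vanishingIdeal] at hf ⊢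
  intro y hy
  refine hf ((specCMap (chartRingTorus t σ.1)).left y) ?_
  intro h
  have h' : (Δ.chartι σ).left ((specCMap (chartRingTorus t σ.1)).left y) ∈ V := h
  rw [← pointMap_torusAction_chartι Δ t σ y] at h'
  exact hy ((Set.ext_iff.1 (hV.stable t) _).1 h')

theorem isUnit_single {S : Type} [AddCommMonoid S] {m n : S} (h : m + n = 0) {c : ℂ}
    (hc : c ≠ 0) : IsUnit (AddMonoidAlgebra.single m c : AddMonoidAlgebra ℂ S) := by
  refine IsUnit.of_mul_eq_one (AddMonoidAlgebra.single n c⁻¹) ?_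
  rw [AddMonoidAlgebra.single_mul_single, AddMonoidAlgebra.one_def, h, mul_inv_cancel₀ hc]

/-- If no member of the cover contains the chart, each complement ideal is proper and graded, so its
elements have no constant term. Their sum has the same property and misses 1; a maximal ideal above
the sum is a point of the chart that no member covers. -/
theorem Fan.isStableIrreducible_chartSet [Module.Free ℤ M] (σ : Δ.Cone) :
    Δ.IsStableIrreducible (Δ.chartSet σ) where
  toIsStableOpen := isStableOpen_chartSet σ
  exists_subset 𝒱 h𝒱 hsub := by
    by_contra! hno
    have hcoeff : ∀ W : 𝒱, ∀ f ∈ complIdeal σ W.1, f.coeff 0 = 0 := by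
      rintro ⟨W, hW⟩ f hf
      by_contra h0
      exact hno W hW (chartSet_subset_of_complIdeal_eq_top (Ideal.eq_top_of_isUnit_mem _
        (single_mem_complIdeal (h𝒱 W hW) hf 0) (isUnit_single (add_zero 0) h0)))
    have hne : (⨆ W : 𝒱, complIdeal σ W.1) ≠ ⊤ := by
      rw [Ideal.ne_top_iff_one]
      intro h1
      have : ∀ f ∈ (⨆ W : 𝒱, complIdeal σ W.1), f.coeff 0 = 0 := by
        intro f hf
        induction hf using Submodule.iSup_induction' with
        | mem W x hx => exact hcoeff W x hx
        | zero => simp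
        | add x y _ _ hx hy => simp [hx, hy]
      have := this 1 h1
      simp at this
    obtain ⟨P, hP, hle⟩ := Ideal.exists_le_maximal _ hne
    let y : PrimeSpectrum (ChartRing σ.1) := ⟨P, hP.isPrime⟩
    obtain ⟨W, hW, hyW⟩ := hsub (show (Δ.chartι σ).left y ∈ Δ.chartSet σ from ⟨y, rfl⟩)
    exact (complIdeal_le_iff (h𝒱 W hW).isOpen y).1
      ((le_iSup (fun W : 𝒱 => complIdeal σ W.1) ⟨W, hW⟩).trans hle) hyW

/-- The face of a cone of the fan cut out by an element of its dual monoid. -/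
def Fan.cutFace (σ : Δ.Cone) (m : dualMonoid σ.1) : Δ.Cone where
  val :=
    { carrier := {v | v ∈ σ.1 ∧ v (m : M) = 0}
      zero_mem' := ⟨zero_mem _, rfl⟩
      add_mem' := fun {a b} ha hb => ⟨add_mem ha.1 hb.1, by
        rw [LinearMap.add_apply, ha.2, hb.2, add_zero]⟩
      smul_mem' := fun c a ha => ⟨Submodule.smul_mem _ c ha.1, by
        change (c : ℝ) * a (m : M) = 0
        rw [ha.2, mul_zero]⟩ }
  property := Δ.face_mem _ σ.2 _ ⟨m, m.2, fun _ => Iff.rfl⟩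

theorem Fan.cutFace_le (σ : Δ.Cone) (m : dualMonoid σ.1) : cutFace σ m ≤ σ := fun _ h => h.1

/-- The chart of the face cut out by m is the basic open set χ^m ≠ 0 of U_σ. -/
theorem Fan.mem_chartSet_cutFace {σ : Δ.Cone} {m : dualMonoid σ.1}
    {y : PrimeSpectrum (ChartRing σ.1)} (h : AddMonoidAlgebra.single m (1 : ℂ) ∉ y.asIdeal) :
    (Δ.chartι σ).left y ∈ Δ.chartSet (cutFace σ m) := by
  obtain ⟨z, rfl⟩ := (Δ.mem_range_charts_map_iff (homOfLE (cutFace_le σ m)) m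
    (fun _ => Iff.rfl) y).2 h
  exact ⟨z, congrArg (fun f => f.left z) (Δ.chartι_w (cutFace_le σ m)).symm⟩

/-- The charts are the only irreducible stable open sets. -/
theorem Fan.IsStableIrreducible.exists_eq_chartSet [Module.Free ℤ M] {V : Set Δ.variety.left}
    (hV : Δ.IsStableIrreducible V) : ∃ τ, V = Δ.chartSet τ := by
  have hfin : Finite Δ.Cone := Δ.finite.to_subtype
  have hex : ∃ τ, V ⊆ Δ.chartSet τ := by
    obtain ⟨_, ⟨τ, rfl⟩, h⟩ := hV.exists_subset (Set.range Δ.chartSet)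
      (by rintro _ ⟨τ, rfl⟩; exact isStableOpen_chartSet τ)
      (fun x _ => by
        obtain ⟨τ, y, hy⟩ := Δ.exists_chartι_eq x
        exact ⟨_, ⟨τ, rfl⟩, y, hy⟩)
    exact ⟨τ, h⟩
  -- V is contained in U_τ with τ minimal. Monomials χ^m in the graded complement ideal give basic
  -- open sets covering V, and these are charts of faces of τ; one of them contains V.
  obtain ⟨τ, hτ⟩ := (Set.toFinite {τ | V ⊆ Δ.chartSet τ}).exists_minimal hex
  refine ⟨τ, hτ.1.antisymm (chartSet_subset_of_complIdeal_eq_top ?_)⟩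
  obtain ⟨_, ⟨m, hm, rfl⟩, hVm⟩ := hV.exists_subset
    ((fun m => Δ.chartSet (cutFace τ m)) '' {m | AddMonoidAlgebra.single m (1 : ℂ) ∈ complIdeal τ V})
    (by rintro _ ⟨m, -, rfl⟩; exact isStableOpen_chartSet _)
    (fun x hx => by
      obtain ⟨y, rfl⟩ := hτ.1 hx
      have hnle : ¬ complIdeal τ V ≤ PrimeSpectrum.asIdeal y :=
        fun h => (complIdeal_le_iff hV.isOpen y).1 h hx
      obtain ⟨f, hfI, hfy⟩ := Set.not_subset.1 hnle
      obtain ⟨m, hm, hmy⟩ : ∃ m ∈ f.coeff.support,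
          AddMonoidAlgebra.single m (f.coeff m) ∉ PrimeSpectrum.asIdeal y := by
        by_contra! hall
        apply hfy
        have : f = ∑ n ∈ f.coeff.support, AddMonoidAlgebra.single n (f.coeff n) := by
          apply AddMonoidAlgebra.coeff_injective
          rw [AddMonoidAlgebra.coeff_sum]
          exact (Finsupp.sum_single f.coeff).symm
        rw [this]
        exact Ideal.sum_mem _ hall
      have e1 : AddMonoidAlgebra.single m (f.coeff m) = AddMonoidAlgebra.single (0 : dualMonoid τ.1)
          (f.coeff m) * AddMonoidAlgebra.single m (1 : ℂ) := by
        rw [AddMonoidAlgebra.single_mul_single, zero_add, mul_one]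
      have hu := isUnit_single (add_zero (0 : dualMonoid τ.1)) (Finsupp.mem_support_iff.1 hm)
      have hmI := single_mem_complIdeal hV.toIsStableOpen hfI m
      rw [e1, Ideal.unit_mul_mem_iff_mem _ hu] at hmI
      rw [e1, Ideal.unit_mul_mem_iff_mem _ hu] at hmy
      exact ⟨_, ⟨m, hmI, rfl⟩, mem_chartSet_cutFace hmy⟩)
  -- By minimality the face is τ itself, so m vanishes on τ and χ^m is a unit of the complement
  -- ideal.
  have hle : τ ≤ cutFace τ m := hτ.2 hVm (cutFace_le τ m)
  have hneg : -(m : M) ∈ dualMonoid τ.1 := fun v hv => by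
    rw [map_neg, (hle hv).2, neg_zero]
  exact Ideal.eq_top_of_isUnit_mem _ hm
    (isUnit_single (n := ⟨_, hneg⟩) (Subtype.ext (add_neg_cancel (m : M))) one_ne_zero)

end

section

variable {M : Type} [AddCommGroup M]

/-! ### Monomial homomorphisms -/

/-- The homomorphism `χ^m ↦ c(m) χ^{α(m)}` from `ℂ[S_τ]` to `ℂ[S_σ]`. -/
def monomialHom {τ σ : PointedCone ℝ (NReal M)} (α : M →ₗ[ℤ] M) (c : Torus M)
    (h : ∀ m ∈ dualMonoid τ, α m ∈ dualMonoid σ) : ChartRing τ →ₐ[ℂ] ChartRing σ :=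
  AddMonoidAlgebra.lift ℂ (ChartRing σ) (dualMonoid τ)
    { toFun := fun m => AddMonoidAlgebra.single ⟨α (m.toAdd : M), h _ m.toAdd.2⟩
        (c (Multiplicative.ofAdd (m.toAdd : M)) : ℂ)
      map_one' := by
        simp [AddMonoidAlgebra.one_def]
        rfl
      map_mul' := fun a b => by
        simp [AddMonoidAlgebra.single_mul_single] }

theorem monomialHom_single {τ σ : PointedCone ℝ (NReal M)} (α : M →ₗ[ℤ] M) (c : Torus M)
    (h : ∀ m ∈ dualMonoid τ, α m ∈ dualMonoid σ) (m : dualMonoid τ) (a : ℂ) :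
    monomialHom α c h (AddMonoidAlgebra.single m a) =
      AddMonoidAlgebra.single ⟨α m, h m m.2⟩ (a * c (Multiplicative.ofAdd (m : M))) := by
  simp [monomialHom]

theorem mem_dualMonoid_bot (m : M) : m ∈ dualMonoid (⊥ : PointedCone ℝ (NReal M)) := by
  intro v hv
  rw [(Submodule.mem_bot _).1 hv]
  rfl

theorem eq_of_single_eq_single {S : Type} {m n : S} {a b : ℂ} (ha : a ≠ 0)
    (h : (AddMonoidAlgebra.single m a : AddMonoidAlgebra ℂ S) = AddMonoidAlgebra.single n b) :
    m = n ∧ a = b := by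
  have h1 := congrArg AddMonoidAlgebra.coeff h
  rw [AddMonoidAlgebra.coeff_single, AddMonoidAlgebra.coeff_single,
    Finsupp.single_eq_single_iff] at h1
  exact h1.resolve_right fun h2 => ha h2.1

theorem chartRingTorus_injective {t s : Torus M}
    (h : chartRingTorus t (⊥ : PointedCone ℝ (NReal M)) = chartRingTorus s ⊥) : t = s := by
  refine MonoidHom.ext fun m => Units.ext ?_
  have := DFunLike.congr_fun h (AddMonoidAlgebra.single ⟨m.toAdd, mem_dualMonoid_bot _⟩ 1)
  rw [chartRingTorus_single, chartRingTorus_single, one_mul, one_mul] at this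
  exact (eq_of_single_eq_single (Units.ne_zero _) this).2

/-- An element of `ℂ[S_σ]` that becomes a monomial in `ℂ[S_τ]` is a monomial. -/
theorem mem_dualMonoid_of_chartRingMap_eq_single {τ σ : PointedCone ℝ (NReal M)} (h : τ ≤ σ)
    {x : ChartRing σ} {m : dualMonoid τ} {a : ℂ} (ha : a ≠ 0)
    (hx : chartRingMap h x = AddMonoidAlgebra.single m a) : (m : M) ∈ dualMonoid σ := by
  by_contra hm
  have h1 : (chartRingMap h x).coeff m = 0 :=
    Finsupp.mapDomain_of_notMem_range x.coeff m (by
      rintro ⟨n, hn⟩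
      exact hm (hn ▸ n.2))
  rw [hx, AddMonoidAlgebra.coeff_single, Finsupp.single_eq_same] at h1
  exact ha h1

variable {Δ : Fan M}

theorem specCMap_comp_chartι_injective {A : Type} [CommRing A] [Algebra ℂ A] {σ : Δ.Cone}
    {f g : ChartRing σ.1 →ₐ[ℂ] A} (h : specCMap f ≫ Δ.chartι σ = specCMap g ≫ Δ.chartι σ) :
    f = g :=
  specCMap_injective ((cancel_mono _).1 h)

/-- On the chart of the zero cone t multiplies each χ^m, m in M, by t(m), so all values of t can be
read off. -/
theorem Fan.torusAction_injective (h : ⊥ ∈ Δ.cones) : Function.Injective Δ.torusAction := by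
  intro t s hts
  refine chartRingTorus_injective (specCMap_comp_chartι_injective (σ := ⟨⊥, h⟩) ?_)
  refine (Δ.chartι_torusAction ⟨⊥, h⟩ t).symm.trans (Eq.trans ?_ (Δ.chartι_torusAction ⟨⊥, h⟩ s))
  rw [hts]

/-- An automorphism mapping a chart into a chart is given by a homomorphism of coordinate
rings. -/
theorem Fan.exists_algHom_of_mapsTo (g : Aut Δ.variety) {σ τ : Δ.Cone}
    (h : Set.MapsTo (Δ.pointMap g) (Δ.chartSet σ) (Δ.chartSet τ)) :
    ∃ φ : ChartRing τ.1 →ₐ[ℂ] ChartRing σ.1,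
      Δ.chartι σ ≫ g.hom = specCMap φ ≫ Δ.chartι τ := by
  have hrange : Set.range (Δ.chartι σ ≫ g.hom).left ⊆ Set.range (Δ.chartι τ).left := by
    rintro _ ⟨y, rfl⟩
    exact h ⟨y, rfl⟩
  let l := IsOpenImmersion.lift (Δ.chartι τ).left (Δ.chartι σ ≫ g.hom).left hrange
  have hl : l ≫ (Δ.chartι τ).left = (Δ.chartι σ ≫ g.hom).left :=
    IsOpenImmersion.lift_fac _ _ _
  have hw : l ≫ (specC (ChartRing τ.1)).hom = (specC (ChartRing σ.1)).hom := by
    rw [← Over.w (Δ.chartι τ), ← Category.assoc, hl, Over.w]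
  obtain ⟨φ, hφ⟩ := specCMap_surjective (Over.homMk l hw : specC (ChartRing σ.1) ⟶ _)
  refine ⟨φ, ?_⟩
  rw [hφ]
  apply Over.OverMorphism.ext
  exact hl.symm

/-! ### The normalizer acts by monomial maps -/

section Normalizer

variable [Module.Free ℤ M]

/-- The normalizer of the torus permutes the charts. -/
theorem Fan.exists_mapsTo_chartSet {g : Aut Δ.variety} (hg : g ∈ Δ.torusNormalizer) (σ : Δ.Cone) :
    ∃ τ, Set.MapsTo (Δ.pointMap g) (Δ.chartSet σ) (Δ.chartSet τ) ∧
      Set.MapsTo (Δ.pointMap g⁻¹) (Δ.chartSet τ) (Δ.chartSet σ) := by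
  obtain ⟨τ, hτ⟩ := ((isStableIrreducible_chartSet σ).preimage (inv_mem hg)).exists_eq_chartSet
  refine ⟨τ, fun x hx => ?_, fun x hx => ?_⟩
  · rw [← hτ, Set.mem_preimage, pointMap_inv_pointMap]
    exact hx
  · rw [← hτ] at hx
    exact hx

/-- The normalizer of the torus preserves the open orbit. -/
theorem Fan.mapsTo_chartSet_bot (h : ⊥ ∈ Δ.cones) {g : Aut Δ.variety}
    (hg : g ∈ Δ.torusNormalizer) :
    Set.MapsTo (Δ.pointMap g) (Δ.chartSet ⟨⊥, h⟩) (Δ.chartSet ⟨⊥, h⟩) := by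
  -- Applied to g⁻¹, this gives a chart U_τ that g maps into U_0; every chart contains U_0.
  obtain ⟨τ, -, hτ⟩ := exists_mapsTo_chartSet (inv_mem hg) ⟨⊥, h⟩
  rw [inv_inv] at hτ
  exact hτ.mono_left (Δ.chartSet_mono bot_le)

/-- On the open orbit, an element of the normalizer of the torus is given by a monomial
homomorphism. -/
theorem Fan.exists_monomialHom_bot (h : ⊥ ∈ Δ.cones) {g : Aut Δ.variety}
    (hg : g ∈ Δ.torusNormalizer) :
    ∃ (α : M →ₗ[ℤ] M) (c : Torus M), Δ.chartι ⟨⊥, h⟩ ≫ g.hom =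
      specCMap (monomialHom α c fun m _ => mem_dualMonoid_bot (α m)) ≫ Δ.chartι ⟨⊥, h⟩ := by
  obtain ⟨φ, hφ⟩ := exists_algHom_of_mapsTo g (mapsTo_chartSet_bot h hg)
  obtain ⟨ψ, hψ⟩ := exists_algHom_of_mapsTo g⁻¹ (mapsTo_chartSet_bot h (inv_mem hg))
  have hψφ : ψ.comp φ = AlgHom.id ℂ _ := by
    apply specCMap_comp_chartι_injective (σ := ⟨⊥, h⟩)
    rw [specCMap_comp, specCMap_id, Category.assoc, ← hφ, ← Category.assoc, ← hψ, Category.assoc]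
    have : g⁻¹.hom ≫ g.hom = 𝟙 _ := g.inv_hom_id
    rw [this, Category.id_comp, Category.comp_id]
  have hinj : Function.Injective φ := Function.LeftInverse.injective (DFunLike.congr_fun hψφ)
  choose t' ht' using exists_torusAction_mul_eq hg
  -- Intertwining makes φ(χ^m) an eigenvector with eigenvalue t'(t)(m), hence a monomial; φ is
  -- injective, so it is nonzero.
  have hcomm : ∀ t, (chartRingTorus t ⊥).comp φ = φ.comp (chartRingTorus (t' t) ⊥) := by
    intro t
    apply specCMap_comp_chartι_injective (σ := ⟨⊥, h⟩)
    have h1 : (Δ.torusAction t).hom ≫ g.hom = g.hom ≫ (Δ.torusAction (t' t)).hom :=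
      congrArg Iso.hom (ht' t)
    rw [specCMap_comp, specCMap_comp, Category.assoc, Category.assoc, ← hφ,
      ← Δ.chartι_torusAction ⟨⊥, h⟩ (t' t), ← Category.assoc (specCMap φ), ← hφ,
      ← Category.assoc, ← Δ.chartι_torusAction ⟨⊥, h⟩ t, Category.assoc, Category.assoc, h1]
  have hmon : ∀ m : M, ∃ (n : M) (c : ℂˣ), φ (AddMonoidAlgebra.single ⟨m, mem_dualMonoid_bot m⟩ 1) =
      AddMonoidAlgebra.single ⟨n, mem_dualMonoid_bot n⟩ (c : ℂ) ∧
      ∀ t : Torus M, t (Multiplicative.ofAdd n) = t' t (Multiplicative.ofAdd m) := by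
    intro m
    have h0 : φ (AddMonoidAlgebra.single ⟨m, mem_dualMonoid_bot m⟩ 1) ≠ 0 := by
      intro h0
      have h1 := hinj (h0.trans (map_zero φ).symm)
      rw [← AddMonoidAlgebra.single_zero ⟨m, mem_dualMonoid_bot m⟩] at h1
      exact one_ne_zero (eq_of_single_eq_single one_ne_zero h1).2
    have h2 : ∀ t, chartRingTorus t ⊥ (φ (AddMonoidAlgebra.single ⟨m, mem_dualMonoid_bot m⟩ 1)) =
        (t' t (Multiplicative.ofAdd m) : ℂ) •
          φ (AddMonoidAlgebra.single ⟨m, mem_dualMonoid_bot m⟩ 1) := by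
      intro t
      refine (DFunLike.congr_fun (hcomm t) _).trans ?_
      rw [AlgHom.comp_apply, chartRingTorus_single, ← map_smul, AddMonoidAlgebra.smul_single,
        smul_eq_mul, mul_comm]
    obtain ⟨n, c, hn, ht⟩ := exists_eq_single_of_eigenvector h0 _ h2
    exact ⟨n, c, hn, fun t => Units.ext (ht t)⟩
  choose a c hac hat using hmon
  -- The exponent a m is determined by its character t ↦ t'(t)(m), which is multiplicative in m.
  have hadd : ∀ m n, a (m + n) = a m + a n := fun m n =>
    eq_of_forall_torus fun t => by rw [hat, ofAdd_add, ofAdd_add, map_mul, map_mul, hat, hat]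
  have hcmul : ∀ m n, c (m + n) = c m * c n := by
    intro m n
    have h1 : φ (AddMonoidAlgebra.single ⟨m + n, mem_dualMonoid_bot _⟩ 1) =
        φ (AddMonoidAlgebra.single ⟨m, mem_dualMonoid_bot m⟩ 1) *
          φ (AddMonoidAlgebra.single ⟨n, mem_dualMonoid_bot n⟩ 1) := by
      rw [← map_mul, AddMonoidAlgebra.single_mul_single, one_mul]
      rfl
    rw [hac, hac, hac, AddMonoidAlgebra.single_mul_single] at h1
    exact Units.ext (eq_of_single_eq_single (Units.ne_zero _) h1).2
  let α : M →ₗ[ℤ] M := (AddMonoidHom.mk' a hadd).toIntLinearMap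
  let χ : Torus M := MonoidHom.mk' (fun m => c m.toAdd) fun m n => hcmul m.toAdd n.toAdd
  refine ⟨α, χ, ?_⟩
  rw [hφ]
  congr 2
  apply chartRing_algHom_ext
  intro m
  rw [monomialHom_single, one_mul]
  exact hac m

omit [Module.Free ℤ M] in
-- Restriction to the open orbit embeds ℂ[S_σ] in ℂ[M], so the formula found there persists on every
-- chart. As the image of χ^m already lies in ℂ[S_σ], its exponent α m must lie in S_σ.
theorem Fan.exists_monomialHom_of_mapsTo (h : ⊥ ∈ Δ.cones) {g : Aut Δ.variety}
    {α : M →ₗ[ℤ] M} {c : Torus M} (hα : Δ.chartι ⟨⊥, h⟩ ≫ g.hom =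
      specCMap (monomialHom α c fun m _ => mem_dualMonoid_bot (α m)) ≫ Δ.chartι ⟨⊥, h⟩)
    {σ τ : Δ.Cone} (hσ : Set.MapsTo (Δ.pointMap g) (Δ.chartSet σ) (Δ.chartSet τ)) :
    ∃ hστ : ∀ m ∈ dualMonoid τ.1, α m ∈ dualMonoid σ.1,
      Δ.chartι σ ≫ g.hom = specCMap (monomialHom α c hστ) ≫ Δ.chartι τ := by
  obtain ⟨φ, hφ⟩ := exists_algHom_of_mapsTo g hσ
  have hcomm : (chartRingMap bot_le).comp φ =
      (monomialHom α c fun m _ => mem_dualMonoid_bot (α m)).comp (chartRingMap bot_le) := by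
    apply specCMap_comp_chartι_injective (σ := τ)
    rw [specCMap_comp, specCMap_comp, Category.assoc, Category.assoc, ← hφ,
      Δ.chartι_w (τ := ⟨⊥, h⟩), ← hα, ← Category.assoc, Δ.chartι_w (τ := ⟨⊥, h⟩)]
  have hsingle : ∀ m : dualMonoid τ.1, chartRingMap bot_le (φ (AddMonoidAlgebra.single m 1)) =
      AddMonoidAlgebra.single ⟨α m, mem_dualMonoid_bot _⟩
        (c (Multiplicative.ofAdd (m : M)) : ℂ) := by
    intro m
    refine (DFunLike.congr_fun hcomm (AddMonoidAlgebra.single m 1)).trans ?_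
    rw [AlgHom.comp_apply, chartRingMap_single, monomialHom_single, one_mul]
    rfl
  have hmem : ∀ m ∈ dualMonoid τ.1, α m ∈ dualMonoid σ.1 := fun m hm =>
    mem_dualMonoid_of_chartRingMap_eq_single _ (Units.ne_zero _) (hsingle ⟨m, hm⟩)
  refine ⟨hmem, ?_⟩
  rw [hφ]
  congr 2
  apply chartRing_algHom_ext
  intro m
  apply chartRingMap_injective bot_le
  rw [hsingle, monomialHom_single, one_mul, chartRingMap_single]
  rfl

/-- An element of the normalizer of the torus is given by monomial homomorphisms on all charts. -/
theorem Fan.exists_monomialHom (h : ⊥ ∈ Δ.cones) {g : Aut Δ.variety}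
    (hg : g ∈ Δ.torusNormalizer) :
    ∃ (α : M ≃ₗ[ℤ] M) (c : Torus M), ∀ σ : Δ.Cone, ∃ (τ : Δ.Cone)
      (hστ : ∀ m, m ∈ dualMonoid τ.1 ↔ α m ∈ dualMonoid σ.1),
      Δ.chartι σ ≫ g.hom =
        specCMap (monomialHom α.toLinearMap c fun m hm => (hστ m).1 hm) ≫ Δ.chartι τ := by
  obtain ⟨α, c, hα⟩ := exists_monomialHom_bot h hg
  obtain ⟨β, d, hβ⟩ := exists_monomialHom_bot h (inv_mem hg)
  have key : ∀ {g : Aut Δ.variety} {α β : M →ₗ[ℤ] M} {c d : Torus M}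
      (_ : Δ.chartι ⟨⊥, h⟩ ≫ g.hom =
        specCMap (monomialHom α c fun m _ => mem_dualMonoid_bot (α m)) ≫ Δ.chartι ⟨⊥, h⟩)
      (_ : Δ.chartι ⟨⊥, h⟩ ≫ g⁻¹.hom =
        specCMap (monomialHom β d fun m _ => mem_dualMonoid_bot (β m)) ≫ Δ.chartι ⟨⊥, h⟩)
      (m : M), α (β m) = m := by
    intro g α β c d hα hβ m
    have h1 : (monomialHom α c fun m _ => mem_dualMonoid_bot (α m)).comp
        (monomialHom β d fun m _ => mem_dualMonoid_bot (β m)) =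
          AlgHom.id ℂ (ChartRing (⊥ : PointedCone ℝ (NReal M))) := by
      apply specCMap_comp_chartι_injective (σ := ⟨⊥, h⟩)
      rw [specCMap_comp, specCMap_id, Category.assoc, ← hβ, ← Category.assoc, ← hα,
        Category.assoc]
      have : g.hom ≫ g⁻¹.hom = 𝟙 _ := g.hom_inv_id
      rw [this, Category.id_comp, Category.comp_id]
    have h2 := DFunLike.congr_fun h1 (AddMonoidAlgebra.single ⟨m, mem_dualMonoid_bot m⟩ 1)
    rw [AlgHom.comp_apply, monomialHom_single, monomialHom_single, AlgHom.id_apply] at h2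
    exact congrArg Subtype.val (eq_of_single_eq_single one_ne_zero h2.symm).1.symm
  have hαβ := key hα hβ
  have hβα := key hβ (by rw [inv_inv]; exact hα)
  refine ⟨LinearEquiv.ofLinearMap α β (LinearMap.ext hαβ) (LinearMap.ext hβα), c, fun σ => ?_⟩
  obtain ⟨τ, hτ, hτ'⟩ := exists_mapsTo_chartSet hg σ
  obtain ⟨h1, hι⟩ := exists_monomialHom_of_mapsTo h hα hτ
  obtain ⟨h2, -⟩ := exists_monomialHom_of_mapsTo h hβ hτ'
  refine ⟨τ, fun m => ⟨h1 m, fun hm => ?_⟩, hι⟩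
  have := h2 _ hm
  rwa [LinearEquiv.coe_ofLinearMap, hβα] at this

end Normalizer

end

section

variable {M : Type} [AddCommGroup M] {Δ : Fan M}

/-! ### Conjugation of the torus by monomial automorphisms -/

theorem torusTransport_apply (γ : M ≃ₗ[ℤ] M) (t : Torus M) (m : M) :
    torusTransport γ t (Multiplicative.ofAdd m) = t (Multiplicative.ofAdd (γ⁻¹ m)) := rfl

theorem torusTransport_mul (γ δ : M ≃ₗ[ℤ] M) (t : Torus M) :
    torusTransport (γ * δ) t = torusTransport γ (torusTransport δ t) := by
  refine MonoidHom.ext fun m => ?_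
  change t (Multiplicative.ofAdd ((γ * δ)⁻¹ m.toAdd)) = t (Multiplicative.ofAdd (δ⁻¹ (γ⁻¹ m.toAdd)))
  rw [mul_inv_rev]
  rfl

theorem torusTransport_one (t : Torus M) : torusTransport (1 : M ≃ₗ[ℤ] M) t = t := rfl

theorem eq_of_forall_torusTransport [Module.Free ℤ M] {γ δ : M ≃ₗ[ℤ] M}
    (h : ∀ t, torusTransport γ t = torusTransport δ t) : γ = δ := by
  have : γ⁻¹ = δ⁻¹ := LinearEquiv.ext fun m => eq_of_forall_torus fun t => by
    rw [← torusTransport_apply, h, torusTransport_apply]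
  exact inv_injective this

/-- The automorphism `g` of the toric variety induces the automorphism `γ` of the torus by
conjugation. -/
def Fan.Induces (g : Aut Δ.variety) (γ : M ≃ₗ[ℤ] M) : Prop :=
  ∀ t, g * Δ.torusAction t * g⁻¹ = Δ.torusAction (torusTransport γ t)

theorem Fan.Induces.mul {g h : Aut Δ.variety} {γ δ : M ≃ₗ[ℤ] M} (hg : Fan.Induces g γ)
    (hh : Fan.Induces h δ) : Fan.Induces (g * h) (γ * δ) := by
  intro t
  rw [torusTransport_mul, ← hg, ← hh]
  group

/-- This makes γ a function of g and, together with `Fan.Induces.mul`, a multiplicative one. -/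
theorem Fan.Induces.unique [Module.Free ℤ M] (h : ⊥ ∈ Δ.cones) {g : Aut Δ.variety}
    {γ δ : M ≃ₗ[ℤ] M} (hγ : Fan.Induces g γ) (hδ : Fan.Induces g δ) : γ = δ :=
  eq_of_forall_torusTransport fun t => torusAction_injective h ((hγ t).symm.trans (hδ t))

theorem Fan.Induces.mem_torusNormalizer {g : Aut Δ.variety} {γ : M ≃ₗ[ℤ] M}
    (hg : Fan.Induces g γ) : g ∈ Δ.torusNormalizer := by
  refine Subgroup.mem_normalizer_iff.2 fun x => ⟨?_, ?_⟩
  · rintro ⟨t, rfl⟩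
    exact ⟨_, (hg t).symm⟩
  · rintro ⟨s, hs⟩
    refine ⟨torusTransport γ⁻¹ s, ?_⟩
    have := hg (torusTransport γ⁻¹ s)
    rw [← torusTransport_mul, mul_inv_cancel, torusTransport_one, hs] at this
    exact mul_left_cancel (mul_right_cancel this)

theorem Fan.induces_torusAction (s : Torus M) : Fan.Induces (Δ.torusAction s) 1 := by
  intro t
  have hst : s * t = t * s := mul_comm s t
  rw [torusTransport_one, ← map_mul, hst, map_mul, mul_inv_cancel_right]

/-- An automorphism given on charts by `χ^m ↦ c(m) χ^{α(m)}` induces `α⁻¹`. -/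
theorem Fan.induces_of_monomialHom {g : Aut Δ.variety} {α : M ≃ₗ[ℤ] M} {c : Torus M}
    (h : ∀ σ : Δ.Cone, ∃ (τ : Δ.Cone) (hστ : ∀ m ∈ dualMonoid τ.1, α m ∈ dualMonoid σ.1),
      Δ.chartι σ ≫ g.hom = specCMap (monomialHom α.toLinearMap c hστ) ≫ Δ.chartι τ) :
    Fan.Induces g α⁻¹ := by
  intro t
  rw [mul_inv_eq_iff_eq_mul]
  apply Iso.ext
  change (Δ.torusAction t).hom ≫ g.hom = g.hom ≫ (Δ.torusAction _).hom
  apply variety_hom_ext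
  intro σ
  obtain ⟨τ, hστ, hg⟩ := h σ
  have e1 : Δ.chartι σ ≫ (Δ.torusAction t).hom ≫ g.hom = specCMap (chartRingTorus t σ.1) ≫
      specCMap (monomialHom α.toLinearMap c hστ) ≫ Δ.chartι τ := by
    rw [← Category.assoc, chartι_torusAction, Category.assoc, hg]
  have e2 : Δ.chartι σ ≫ g.hom ≫ (Δ.torusAction (torusTransport α⁻¹ t)).hom =
      specCMap (monomialHom α.toLinearMap c hστ) ≫
        specCMap (chartRingTorus (torusTransport α⁻¹ t) τ.1) ≫ Δ.chartι τ := by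
    rw [← Category.assoc, hg, Category.assoc, chartι_torusAction]
  refine e1.trans (Eq.trans ?_ e2.symm)
  rw [← Category.assoc, ← Category.assoc, ← specCMap_comp, ← specCMap_comp]
  congr 2
  apply chartRing_algHom_ext
  intro m
  rw [AlgHom.comp_apply, AlgHom.comp_apply, monomialHom_single, chartRingTorus_single,
    chartRingTorus_single, monomialHom_single, torusTransport_apply, inv_inv]
  congr 1
  rw [one_mul, one_mul, mul_comm]
  rfl

/-! ### From the normalizer to symmetries, and the centralizer -/

section Normalizer

variable [Module.Free ℤ M] [Module.Finite ℤ M]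

/-- Every element of the normalizer of the torus induces a symmetry of the fan. -/
theorem Fan.exists_induces (hr : Δ.IsRegular) (h : ⊥ ∈ Δ.cones) {g : Aut Δ.variety}
    (hg : g ∈ Δ.torusNormalizer) : ∃ γ ∈ Δ.symmetryGroup, Fan.Induces g γ := by
  obtain ⟨α, c, hα⟩ := exists_monomialHom h hg
  refine ⟨α⁻¹, ?_, induces_of_monomialHom (c := c) fun σ => ?_⟩
  · rw [inv_mem_iff]
    -- Each σ is the image under α of the τ with g(U_σ) = U_τ, by duality. One inclusion suffices,
    -- since the image has at most as many cones as the finite fan.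
    have hsub : Δ.cones ⊆ PointedCone.map (realAction α) '' Δ.cones := by
      intro σ hσ
      obtain ⟨τ, hτ, -⟩ := hα ⟨σ, hσ⟩
      refine ⟨τ.1, τ.2, ?_⟩
      have key : ∀ v, v ∈ τ.1 ↔ realAction α v ∈ σ := by
        intro v
        rw [(hr _ τ.2).mem_iff, (hr _ hσ).mem_iff]
        constructor
        · intro hv m hm
          refine hv _ ((hτ _).2 ?_)
          have : α (α⁻¹ m) = m := α.apply_symm_apply m
          change α (α⁻¹ m) ∈ _
          rwa [this]
        · intro hv m hm
          have := hv _ ((hτ m).1 hm)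
          have hm' : α⁻¹ (α m) = m := α.symm_apply_apply m
          rwa [realAction_apply, hm'] at this
      ext v
      constructor
      · rintro ⟨w, hw, rfl⟩
        exact (key w).1 hw
      · intro hv
        have hw : realAction α (realAction α⁻¹ v) = v := by
          simpa using realAction_inv_cancel α⁻¹ v
        exact ⟨realAction α⁻¹ v, (key _).2 (by rwa [hw]), hw⟩
    exact (Set.eq_of_subset_of_ncard_le hsub (Set.ncard_image_le Δ.finite)
      (Δ.finite.image _)).symm
  · obtain ⟨τ, hτ, e⟩ := hα σ
    exact ⟨τ, fun m hm => (hτ m).1 hm, e⟩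

/-- The centralizer of the torus is the torus. -/
theorem Fan.Induces.mem_torus (hr : Δ.IsRegular) (h : ⊥ ∈ Δ.cones) {g : Aut Δ.variety}
    (hg : Fan.Induces g 1) : g ∈ Δ.torus := by
  obtain ⟨α, c, hα⟩ := exists_monomialHom h hg.mem_torusNormalizer
  have h1 : Fan.Induces g α⁻¹ := induces_of_monomialHom (c := c) fun σ => by
    obtain ⟨τ, hτ, e⟩ := hα σ
    exact ⟨τ, fun m hm => (hτ m).1 hm, e⟩
  obtain rfl : α = 1 := inv_eq_one.1 (h1.unique h hg)
  refine ⟨c, ?_⟩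
  apply Iso.ext
  apply variety_hom_ext
  intro σ
  obtain ⟨τ, hτ, e⟩ := hα σ
  -- With α = 1 the two dual monoids coincide, and regular cones are determined by them.
  obtain rfl : τ = σ := by
    apply Subtype.ext
    ext v
    rw [(hr _ τ.2).mem_iff, (hr _ σ.2).mem_iff]
    exact forall_congr' fun m => imp_congr_left (hτ m)
  rw [e, chartι_torusAction]
  congr 2

end Normalizer

/-! ### The automorphism of the toric variety given by a symmetry of the fan -/

theorem dualMonoid_of_map_le {γ : M ≃ₗ[ℤ] M} {σ τ : PointedCone ℝ (NReal M)}
    (h : PointedCone.map (realAction γ) σ ≤ τ) (m : M) (hm : m ∈ dualMonoid τ) :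
    γ⁻¹ m ∈ dualMonoid σ :=
  fun v hv => hm _ (h ⟨v, hv, rfl⟩)

/-- The morphism `U_σ → U_τ` given by an element of `GL(M)` that maps `σ` into `τ`. -/
def chartMap (γ : M ≃ₗ[ℤ] M) {σ τ : PointedCone ℝ (NReal M)}
    (h : PointedCone.map (realAction γ) σ ≤ τ) : specC (ChartRing σ) ⟶ specC (ChartRing τ) :=
  specCMap (monomialHom (γ⁻¹ : M ≃ₗ[ℤ] M).toLinearMap 1 (dualMonoid_of_map_le h))

theorem Fan.chartMap_chartι {γ : M ≃ₗ[ℤ] M} {σ : PointedCone ℝ (NReal M)} {τ τ' : Δ.Cone}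
    (h : PointedCone.map (realAction γ) σ ≤ τ.1) (hτ : τ.1 ≤ τ'.1) :
    chartMap γ h ≫ Δ.chartι τ = chartMap γ (h.trans hτ) ≫ Δ.chartι τ' := by
  rw [← Δ.chartι_w hτ, ← Category.assoc, chartMap, chartMap, ← specCMap_comp]
  congr 2
  apply chartRing_algHom_ext
  intro m
  rw [AlgHom.comp_apply, chartRingMap_single, monomialHom_single, monomialHom_single]
  rfl

theorem chartRingMap_chartMap {γ : M ≃ₗ[ℤ] M} {σ σ' τ : PointedCone ℝ (NReal M)}
    (hσ : σ' ≤ σ) (h : PointedCone.map (realAction γ) σ ≤ τ) :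
    specCMap (chartRingMap hσ) ≫ chartMap γ h =
      chartMap γ ((Submodule.map_mono hσ).trans h) := by
  unfold chartMap
  rw [← specCMap_comp]
  congr 1
  apply chartRing_algHom_ext
  intro m
  rw [AlgHom.comp_apply, monomialHom_single, monomialHom_single, chartRingMap_single]
  rfl

theorem chartMap_chartMap {γ δ : M ≃ₗ[ℤ] M} (hδ : δ * γ = 1) {σ τ : PointedCone ℝ (NReal M)}
    (h : PointedCone.map (realAction γ) σ ≤ τ) (h' : PointedCone.map (realAction δ) τ ≤ σ) :
    chartMap γ h ≫ chartMap δ h' = 𝟙 _ := by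
  unfold chartMap
  rw [← specCMap_comp, ← specCMap_id]
  congr 1
  apply chartRing_algHom_ext
  intro m
  rw [AlgHom.comp_apply, monomialHom_single, monomialHom_single, AlgHom.id_apply]
  congr 1
  · apply Subtype.ext
    change (γ⁻¹ * δ⁻¹) (m : M) = m
    rw [← mul_inv_rev, hδ, inv_one]
    rfl
  · simp

/-- The image of a cone of the fan under a symmetry of the fan. -/
def Fan.mapCone {γ : M ≃ₗ[ℤ] M} (hγ : γ ∈ Δ.symmetryGroup) (σ : Δ.Cone) : Δ.Cone :=
  ⟨PointedCone.map (realAction γ) σ.1, Δ.map_realAction_mem hγ σ.2⟩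

theorem Fan.map_le_mapCone {γ : M ≃ₗ[ℤ] M} (hγ : γ ∈ Δ.symmetryGroup) (σ : Δ.Cone) :
    PointedCone.map (realAction γ) σ.1 ≤ (mapCone hγ σ).1 :=
  le_rfl

/-- The restriction to a chart of the endomorphism of the toric variety given by a symmetry. -/
def Fan.symmetryLeg {γ : M ≃ₗ[ℤ] M} (hγ : γ ∈ Δ.symmetryGroup) (σ : Δ.Cone) :
    specC (ChartRing σ.1) ⟶ Δ.variety :=
  chartMap γ (map_le_mapCone hγ σ) ≫ Δ.chartι (mapCone hγ σ)

/-- The leg may be computed in any chart whose cone contains the image of σ; this freedom gives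
compatibility with the gluing maps. -/
theorem Fan.symmetryLeg_eq {γ : M ≃ₗ[ℤ] M} (hγ : γ ∈ Δ.symmetryGroup) {σ τ : Δ.Cone}
    (h : PointedCone.map (realAction γ) σ.1 ≤ τ.1) :
    symmetryLeg hγ σ = chartMap γ h ≫ Δ.chartι τ :=
  chartMap_chartι (map_le_mapCone hγ σ) h

theorem Fan.chartRingMap_symmetryLeg {γ : M ≃ₗ[ℤ] M} (hγ : γ ∈ Δ.symmetryGroup) {τ σ : Δ.Cone}
    (h : τ.1 ≤ σ.1) :
    specCMap (chartRingMap h) ≫ symmetryLeg hγ σ = symmetryLeg hγ τ := by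
  have h' : PointedCone.map (realAction γ) τ.1 ≤ (mapCone hγ σ).1 := Submodule.map_mono h
  rw [symmetryLeg_eq hγ h', symmetryLeg, ← Category.assoc, chartRingMap_chartMap]

/-- The endomorphism of the toric variety given by a symmetry of the fan. -/
def Fan.symmetryHom {γ : M ≃ₗ[ℤ] M} (hγ : γ ∈ Δ.symmetryGroup) : Δ.variety ⟶ Δ.variety :=
  colimit.desc Δ.charts
    { pt := Δ.variety
      ι :=
        { app := symmetryLeg hγ
          naturality := fun _ _ f =>
            (chartRingMap_symmetryLeg hγ (leOfHom f)).trans (Category.comp_id _).symm } }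

theorem Fan.chartι_symmetryHom {γ : M ≃ₗ[ℤ] M} (hγ : γ ∈ Δ.symmetryGroup) {σ τ : Δ.Cone}
    (h : PointedCone.map (realAction γ) σ.1 ≤ τ.1) :
    Δ.chartι σ ≫ symmetryHom hγ = chartMap γ h ≫ Δ.chartι τ :=
  (colimit.ι_desc _ σ).trans (symmetryLeg_eq hγ h)

theorem Fan.symmetryHom_comp {γ δ : M ≃ₗ[ℤ] M} (hγ : γ ∈ Δ.symmetryGroup)
    (hδ : δ ∈ Δ.symmetryGroup) (h : δ * γ = 1) : symmetryHom hγ ≫ symmetryHom hδ = 𝟙 _ := by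
  apply variety_hom_ext
  intro σ
  have h' : PointedCone.map (realAction δ) (mapCone hγ σ).1 ≤ σ.1 := by
    change PointedCone.map (realAction δ) (PointedCone.map (realAction γ) σ.1) ≤ σ.1
    rw [← map_realAction_mul, h, map_realAction_one]
  rw [← Category.assoc,
    chartι_symmetryHom hγ (map_le_mapCone hγ σ), Category.assoc,
    chartι_symmetryHom hδ (τ := σ) h', ← Category.assoc, chartMap_chartMap h, Category.id_comp,
    Category.comp_id]

/-- The automorphism of the toric variety given by a symmetry of the fan. -/
def Fan.symmetryAut {γ : M ≃ₗ[ℤ] M} (hγ : γ ∈ Δ.symmetryGroup) : Aut Δ.variety where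
  hom := symmetryHom hγ
  inv := symmetryHom (inv_mem hγ)
  hom_inv_id := symmetryHom_comp _ _ (inv_mul_cancel γ)
  inv_hom_id := symmetryHom_comp _ _ (mul_inv_cancel γ)

theorem Fan.induces_symmetryAut {γ : M ≃ₗ[ℤ] M} (hγ : γ ∈ Δ.symmetryGroup) :
    Fan.Induces (symmetryAut hγ) γ := by
  have := induces_of_monomialHom (g := symmetryAut hγ) (α := γ⁻¹) (c := 1) fun σ =>
    ⟨mapCone hγ σ, dualMonoid_of_map_le (map_le_mapCone hγ σ), chartι_symmetryHom hγ (map_le_mapCone hγ σ)⟩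
  rwa [inv_inv] at this

end

end Toric

end

/-! ### The isomorphism of the Weyl group with the symmetry group -/

theorem proposition3p1 {M : Type} [AddCommGroup M] [Module.Free ℤ M] [Module.Finite ℤ M]
    (Δ : Toric.Fan M) (hcomplete : Δ.IsComplete) (hregular : Δ.IsRegular) :
    Finite Δ.symmetryGroup ∧
      ∃ e : Δ.weylGroup ≃* Δ.symmetryGroup,
        ∀ (g : Δ.torusNormalizer) (t : Toric.Torus M),
          (g : Aut Δ.variety) * Δ.torusAction t * (g : Aut Δ.variety)⁻¹ =
            Δ.torusAction (Toric.torusTransport (e (QuotientGroup.mk g) : M ≃ₗ[ℤ] M) t) := by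
  have hbot := Δ.bot_mem hcomplete hregular
  refine ⟨Δ.finite_symmetryGroup hcomplete hregular, ?_⟩
  choose f hf hfi using fun g : Δ.torusNormalizer => Toric.Fan.exists_induces hregular hbot g.2
  let F : Δ.torusNormalizer →* Δ.symmetryGroup :=
    MonoidHom.mk' (fun g => ⟨f g, hf g⟩) fun g h =>
      Subtype.ext ((hfi (g * h)).unique hbot ((hfi g).mul (hfi h)))
  have hsurj : Function.Surjective F := fun γ =>
    ⟨⟨Toric.Fan.symmetryAut γ.2, (Toric.Fan.induces_symmetryAut γ.2).mem_torusNormalizer⟩,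
      Subtype.ext ((hfi _).unique hbot (Toric.Fan.induces_symmetryAut γ.2))⟩
  -- The kernel consists of the elements centralizing T: commutativity puts T inside it, and
  -- `Fan.Induces.mem_torus` shows there is nothing else.
  have hker : Δ.torus.subgroupOf Δ.torusNormalizer = F.ker := by
    ext g
    rw [Subgroup.mem_subgroupOf, MonoidHom.mem_ker]
    constructor
    · rintro ⟨s, hs⟩
      have := Δ.induces_torusAction s
      rw [hs] at this
      exact Subtype.ext ((hfi g).unique hbot this)
    · intro hg
      have h1 := hfi g
      rw [show f g = 1 from congrArg Subtype.val hg] at h1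
      exact h1.mem_torus hregular hbot
  exact ⟨(QuotientGroup.quotientMulEquivOfEq hker).trans
    (QuotientGroup.quotientKerEquivOfSurjective F hsurj), fun g t => hfi g t⟩
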